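/- **Setting.** Let $\Omega\subset\mathbb R^d$ be a bounded domain (a nonempty connected open set; in particular any bounded Lipschitz domain) and let $V$ be a closed subspace of $H^1(\Omega)$ with $H^1_0(\Omega)\subset V$. Let $u\in V$ solve $a(u,v)=\ell(v)$ for all $v\in V$, where $$a(w,v)=\int_\Omega \alpha\nabla w\cdot\nabla v+\sigma wv\,dx,\qquad \ell(v)=\int_\Omega fv\,dx,$$ with $f\in L^2(\Omega)$, measurable $0<\alpha_{\min}\le\alpha\le\alpha_{\max}$, $0\le\sigma\le\sigma_{\max}$ a.e., and $a$ coercive on $V$ with respect to the $H^1$-norm. Let $\tilde a,\tilde\ell$ be given in the same way by $\tilde\alpha,\tilde\sigma,\tilde f$, with $0<\tilde\alpha_{\min}\le\tilde\alpha\le\tilde\alpha_{\max}$, $0\le\tilde\sigma\le\tilde\sigma_{\max}$ a.e. (coercivity of $\tilde a$ is not assumed). Let $B_1,\dots,B_m\subset\Omega$ be nonempty open sets and $K_i\supset B_i$ bounded convex sets with $\Omega\subset\bigcup_i\overline{K_i}$, such that each $K_i\cap\Omega$ is convex (as is the case if $K_i\subset\Omega$ or if $\Omega$ is convex). Put $$M=\max_{x\in\Omega}|\{i: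 x\in K_i\}|,\quad R=\max_i\operatorname{diam}K_i,\quad \eta=\begin{cases}1&\text{if }B_i=K_i\ \forall i,\\ 3\max_i|K_i|/|B_i|&\text{otherwise.}\end{cases}$$ For $\delta>0$ and data $b_1,\dots,b_m\in\mathbb R$ let $$b(w,v)=\sum_{i=1}^m|B_i|\,\langle w\rangle_{B_i}\langle v\rangle_{B_i},\qquad \widetilde{b(u,v)}=\sum_{i=1}^m b_i|B_i|\,\langle v\rangle_{B_i},$$ where $\langle v\rangle_{B_i}=|B_i|^{-1}\int_{B_i}v\,dx$ denotes the average, and $$\tilde c=\tilde a+\delta^{-1}b,\quad \|v\|_{\tilde c}=\tilde c(v,v)^{1/2},\quad \tilde J(v)=\tfrac12\tilde c(v,v)-\tilde\ell(v)-\delta^{-1}\widetilde{b(u,v)},\quad \Gamma=\eta\max\Bigl\{\frac{R^2M}{\pi^2\tilde\alpha_{\min}},\delta\Bigr\}.$$ **Non-degenerate, well-balanced.** These notions refer to families of problems: $\eta$ and $M$ are bounded, and there is $\theta\in(0,1]$ with $\theta^{-1}$ bounded and $\theta\frac{R^2M}{\pi^2\tilde\alpha_{\min}}\le\delta\le\theta^{-1}\frac{R^2M}{\pi^2\tilde\alpha_{\min}}$.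 Below, $C$ denotes a constant that depends only on $d$, on upper bounds for $\eta$, $M$, $\theta^{-1}$, $\tilde\alpha_{\max}$, $\tilde\sigma_{\max}$ and $R$, and on a positive lower bound for $\tilde\alpha_{\min}$; it is otherwise uniform over all problems as above. **Error terms.** A functional $F$ on $V$ is said to belong to $L^2(\Omega)$ if there is $g\in L^2(\Omega)$ with $F(v)=\int_\Omega gv\,dx$ for all $v\in V$ (such $g$ is unique), and then $\|F\|_{L^2(\Omega)}=\|g\|_{L^2(\Omega)}$. For $V_h\subset V$ put $$E_{\rm pde}=\|\tilde\ell-\tilde a(u,\cdot)\|_{L^2(\Omega)},\quad E_{\rm data}=\|\widetilde{b(u,\cdot)}-b(u,\cdot)\|_{L^2(\Omega)},\quad E_{\rm approx}=\inf_{v\in V_h}\bigl(R\|\nabla(v-u)\|_{L^2(\Omega)}+\|v-u\|_{L^2(\Omega)}\bigr).$$ **Corollary.** There is such a constant $C>0$ with the following properties. 1. $\sqrt\Gamma\,\|v\|_{\tilde c}\le C\bigl(R\|\nabla v\|_{L^2(\Omega)}+\|v\|_{L^2(\Omega)}\bigr)$ for all $v\in H^1(\Omega)$. 2. If $\tilde\ell-\tilde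 a(u,\cdot)\in L^2(\Omega)$, then for every subset $V_h\subset V$ (not necessarily a subspace) and every minimizer $\tilde u_h\in V_h$ of $\tilde J$ over $V_h$, $$\|\tilde u_h-u\|_{L^2(\Omega)}\le C\,E_{\rm approx}+CR^2E_{\rm pde}+C\,E_{\rm data}.$$ -/

import Mathlib

open MeasureTheory Set
open scoped ContDiff ENNReal

noncomputable section

namespace PDELearning

/-- The Euclidean space `ℝ^d`. -/
abbrev Sp (d : ℕ) : Type := EuclideanSpace ℝ (Fin d)

/-- The scalar space `L²(Ω)`. -/
abbrev L2 {d : ℕ} (Ω : Set (Sp d)) : Type := Lp ℝ 2 (volume.restrict Ω)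

/-- The space `L²(Ω; ℝ^d)` of square integrable vector fields. -/
abbrev L2Vec {d : ℕ} (Ω : Set (Sp d)) : Type := Lp (Sp d) 2 (volume.restrict Ω)

/-- Test functions on `Ω`, i.e. smooth functions with compact support in `Ω`. -/
structure IsTestFunction {d : ℕ} (Ω : Set (Sp d)) (φ : Sp d → ℝ) : Prop where
  smooth : ContDiff ℝ ∞ φ
  compact : HasCompactSupport φ
  support : tsupport φ ⊆ Ω

/-- `G` is the weak gradient of `w` on `Ω`: the integration by parts formula holds against all
test functions and for the derivatives in all directions `e`. -/
def IsWeakGradient {d : ℕ} (Ω : Set (Sp d)) (w : L2 Ω) (G : L2Vec Ω) : Prop :=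
  ∀ φ : Sp d → ℝ, IsTestFunction Ω φ → ∀ e : Sp d,
    ∫ x in Ω, w x * fderiv ℝ φ x e = - ∫ x in Ω, inner ℝ (G x) e * φ x

theorem IsTestFunction.memLp {d : ℕ} {Ω : Set (Sp d)} {φ : Sp d → ℝ}
    (h : IsTestFunction Ω φ) : MemLp φ 2 (volume.restrict Ω) :=
  h.smooth.continuous.memLp_of_hasCompactSupport h.compact

theorem IsTestFunction.memLp_fderiv {d : ℕ} {Ω : Set (Sp d)} {φ : Sp d → ℝ}
    (h : IsTestFunction Ω φ) (e : Sp d) :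
    MemLp (fun x => fderiv ℝ φ x e) 2 (volume.restrict Ω) := by
  have hc : Continuous (fun x => fderiv ℝ φ x e) :=
    (h.smooth.continuous_fderiv (by simp)).clm_apply continuous_const
  exact hc.memLp_of_hasCompactSupport (h.compact.fderiv_apply ℝ e)

theorem integrable_mul_fderiv {d : ℕ} {Ω : Set (Sp d)} {φ : Sp d → ℝ}
    (h : IsTestFunction Ω φ) (w : L2 Ω) (e : Sp d) :
    IntegrableOn (fun x => w x * fderiv ℝ φ x e) Ω :=
  (Lp.memLp w).integrable_mul (h.memLp_fderiv e)

theorem integrable_inner_mul {d : ℕ} {Ω : Set (Sp d)} {φ : Sp d → ℝ}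
    (h : IsTestFunction Ω φ) (G : L2Vec Ω) (e : Sp d) :
    IntegrableOn (fun x => inner ℝ (G x) e * φ x) Ω :=
  ((Lp.memLp G).inner_const e).integrable_mul h.memLp

theorem IsWeakGradient.zero {d : ℕ} (Ω : Set (Sp d)) :
    IsWeakGradient Ω (0 : L2 Ω) (0 : L2Vec Ω) := by
  intro φ _ e
  have h1 : ∫ x in Ω, (0 : L2 Ω) x * fderiv ℝ φ x e = 0 := by
    refine integral_eq_zero_of_ae ?_
    filter_upwards [AEEqFun.coeFn_zero (μ := volume.restrict Ω) (β := ℝ)] with x hx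
    erw [hx]; simp
  have h2 : ∫ x in Ω, inner ℝ ((0 : L2Vec Ω) x) e * φ x = 0 := by
    refine integral_eq_zero_of_ae ?_
    filter_upwards [AEEqFun.coeFn_zero (μ := volume.restrict Ω) (β := Sp d)] with x hx
    erw [hx]; simp
  rw [h1, h2, neg_zero]

theorem IsWeakGradient.add {d : ℕ} {Ω : Set (Sp d)} {w w' : L2 Ω} {G G' : L2Vec Ω}
    (h : IsWeakGradient Ω w G) (h' : IsWeakGradient Ω w' G') :
    IsWeakGradient Ω (w + w') (G + G') := by
  intro φ hφ e
  have h1 : ∫ x in Ω, (w + w' : L2 Ω) x * fderiv ℝ φ x e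
      = (∫ x in Ω, w x * fderiv ℝ φ x e) + ∫ x in Ω, w' x * fderiv ℝ φ x e := by
    rw [← integral_add (integrable_mul_fderiv hφ w e) (integrable_mul_fderiv hφ w' e)]
    refine integral_congr_ae ?_
    filter_upwards [Lp.coeFn_add w w'] with x hx
    rw [hx, Pi.add_apply, add_mul]
  have h2 : ∫ x in Ω, inner ℝ ((G + G' : L2Vec Ω) x) e * φ x
      = (∫ x in Ω, inner ℝ (G x) e * φ x) + ∫ x in Ω, inner ℝ (G' x) e * φ x := by
    rw [← integral_add (integrable_inner_mul hφ G e) (integrable_inner_mul hφ G' e)]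
    refine integral_congr_ae ?_
    filter_upwards [Lp.coeFn_add G G'] with x hx
    rw [hx, Pi.add_apply, inner_add_left, add_mul]
  rw [h1, h2, h φ hφ e, h' φ hφ e, neg_add]

theorem IsWeakGradient.smul {d : ℕ} {Ω : Set (Sp d)} {w : L2 Ω} {G : L2Vec Ω} (c : ℝ)
    (h : IsWeakGradient Ω w G) : IsWeakGradient Ω (c • w) (c • G) := by
  intro φ hφ e
  have h1 : ∫ x in Ω, (c • w : L2 Ω) x * fderiv ℝ φ x e
      = c * ∫ x in Ω, w x * fderiv ℝ φ x e := by
    rw [← integral_const_mul]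
    refine integral_congr_ae ?_
    filter_upwards [Lp.coeFn_smul c w] with x hx
    rw [hx, Pi.smul_apply, smul_eq_mul, mul_assoc]
  have h2 : ∫ x in Ω, inner ℝ ((c • G : L2Vec Ω) x) e * φ x
      = c * ∫ x in Ω, inner ℝ (G x) e * φ x := by
    rw [← integral_const_mul]
    refine integral_congr_ae ?_
    filter_upwards [Lp.coeFn_smul c G] with x hx
    rw [hx, Pi.smul_apply, real_inner_smul_left, mul_assoc]
  rw [h1, h2, h φ hφ e, mul_neg]

/-- The Sobolev space `H¹(Ω)`, as the space of pairs `(w, ∇w)` in `L²(Ω) × L²(Ω; ℝ^d)` with the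
norm `(‖w‖² + ‖∇w‖²)^(1/2)`. -/
def H1 {d : ℕ} (Ω : Set (Sp d)) : Submodule ℝ (WithLp 2 (L2 Ω × L2Vec Ω)) where
  carrier := {p | IsWeakGradient Ω p.fst p.snd}
  add_mem' := fun hp hq => hp.add hq
  zero_mem' := IsWeakGradient.zero Ω
  smul_mem' := fun c _ hp => hp.smul c

/-- The function in `L²(Ω)` underlying an element of `H¹(Ω)`. -/
def fn {d : ℕ} {Ω : Set (Sp d)} (v : H1 Ω) : L2 Ω := (v : WithLp 2 (L2 Ω × L2Vec Ω)).fst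

/-- The weak gradient of an element of `H¹(Ω)`. -/
def grad {d : ℕ} {Ω : Set (Sp d)} (v : H1 Ω) : L2Vec Ω :=
  (v : WithLp 2 (L2 Ω × L2Vec Ω)).snd

/-- `H¹₀(Ω)`, the closure of the test functions in `H¹(Ω)`. -/
def H10 {d : ℕ} (Ω : Set (Sp d)) : Submodule ℝ (H1 Ω) :=
  (Submodule.span ℝ
    {v : H1 Ω | ∃ φ, IsTestFunction Ω φ ∧ fn v =ᵐ[volume.restrict Ω] φ}).topologicalClosure

/-- The coefficients `α`, `σ` and the right hand side `f` of an elliptic equation on `Ω`, with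
`0 < αMin ≤ α ≤ αMax` and `0 ≤ σ ≤ σMax` almost everywhere and `f ∈ L²(Ω)`. -/
structure EllipticData {d : ℕ} (Ω : Set (Sp d)) where
  α : Sp d → ℝ
  σ : Sp d → ℝ
  f : L2 Ω
  αMin : ℝ
  αMax : ℝ
  σMax : ℝ
  αMin_pos : 0 < αMin
  α_meas : AEStronglyMeasurable α (volume.restrict Ω)
  σ_meas : AEStronglyMeasurable σ (volume.restrict Ω)
  α_bound : ∀ᵐ x ∂(volume.restrict Ω), αMin ≤ α x ∧ α x ≤ αMax
  σ_bound : ∀ᵐ x ∂(volume.restrict Ω), 0 ≤ σ x ∧ σ x ≤ σMax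

/-- The bilinear form `∫_Ω α ∇w · ∇v + σ w v`. -/
def EllipticData.a {d : ℕ} {Ω : Set (Sp d)} (P : EllipticData Ω) (w v : H1 Ω) : ℝ :=
  ∫ x in Ω, (P.α x * inner ℝ (grad w x) (grad v x) + P.σ x * fn w x * fn v x)

/-- The linear functional `∫_Ω f v`. -/
def EllipticData.ℓ {d : ℕ} {Ω : Set (Sp d)} (P : EllipticData Ω) (v : H1 Ω) : ℝ :=
  ∫ x in Ω, P.f x * fn v x

/-- The bilinear form is coercive on `V` with respect to the `H¹`-norm. -/
def EllipticData.IsCoerciveOn {d : ℕ} {Ω : Set (Sp d)} (P : EllipticData Ω)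
    (V : Submodule ℝ (H1 Ω)) : Prop :=
  ∃ c > 0, ∀ v ∈ V, c * ‖v‖ ^ 2 ≤ P.a v v

/-- `u ∈ V` solves the variational equation `a(u, v) = ℓ(v)` for all `v ∈ V`. -/
def EllipticData.IsSolution {d : ℕ} {Ω : Set (Sp d)} (P : EllipticData Ω)
    (V : Submodule ℝ (H1 Ω)) (u : H1 Ω) : Prop :=
  u ∈ V ∧ ∀ v ∈ V, P.a u v = P.ℓ v

/-- The sets used for local averaging: nonempty open sets `B i ⊆ Ω`, and bounded convex sets
`K i ⊇ B i` whose closures cover `Ω`. Each `K i ∩ Ω` is required to be convex; this holds if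
`K i ⊆ Ω` and also if `Ω` is convex. -/
structure Patches {d : ℕ} (Ω : Set (Sp d)) (m : ℕ) where
  B : Fin m → Set (Sp d)
  K : Fin m → Set (Sp d)
  B_open : ∀ i, IsOpen (B i)
  B_nonempty : ∀ i, (B i).Nonempty
  B_subset : ∀ i, B i ⊆ Ω
  B_subset_K : ∀ i, B i ⊆ K i
  K_convex : ∀ i, Convex ℝ (K i)
  K_bounded : ∀ i, Bornology.IsBounded (K i)
  K_inter_convex : ∀ i, Convex ℝ (K i ∩ Ω)
  cover : Ω ⊆ ⋃ i, closure (K i)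

/-- The maximal overlap `M = max_{x ∈ Ω} |{i | x ∈ K i}|`. -/
def Patches.M {d m : ℕ} {Ω : Set (Sp d)} (D : Patches Ω m) : ℕ :=
  sSup ((fun x => {i | x ∈ D.K i}.ncard) '' Ω)

/-- The maximal diameter `R = max_i diam (K i)`. -/
def Patches.R {d m : ℕ} {Ω : Set (Sp d)} (D : Patches Ω m) : ℝ :=
  ⨆ i, Metric.diam (D.K i)

open Classical in
/-- The mismatch constant: `η = 1` if `B i = K i` for all `i`, and
`η = 3 max_i |K i| / |B i|` otherwise. -/
def Patches.η {d m : ℕ} {Ω : Set (Sp d)} (D : Patches Ω m) : ℝ :=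
  if ∀ i, D.B i = D.K i then 1
  else 3 * ⨆ i, volume.real (D.K i) / volume.real (D.B i)

/-- The data form `b(w, v) = ∑ i, |B i| (⨍_{B i} w) (⨍_{B i} v)`. -/
def Patches.b {d m : ℕ} {Ω : Set (Sp d)} (D : Patches Ω m) (w v : H1 Ω) : ℝ :=
  ∑ i, volume.real (D.B i) * (⨍ x in D.B i, fn w x) * (⨍ x in D.B i, fn v x)

/-- The inexact data functional `v ↦ ∑ i, β i |B i| ⨍_{B i} v` for given values `β i`. -/
def Patches.bData {d m : ℕ} {Ω : Set (Sp d)} (D : Patches Ω m) (β : Fin m → ℝ) (v : H1 Ω) : ℝ :=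
  ∑ i, β i * volume.real (D.B i) * (⨍ x in D.B i, fn v x)

/-- The augmented form `c(w, v) = a(w, v) + δ⁻¹ b(w, v)`. -/
def augForm {d m : ℕ} {Ω : Set (Sp d)} (P : EllipticData Ω) (D : Patches Ω m) (δ : ℝ)
    (w v : H1 Ω) : ℝ :=
  P.a w v + δ⁻¹ * D.b w v

/-- The semi-norm `‖v‖_c = c(v, v)^(1/2)` induced by the augmented form. -/
def augNorm {d m : ℕ} {Ω : Set (Sp d)} (P : EllipticData Ω) (D : Patches Ω m) (δ : ℝ)
    (v : H1 Ω) : ℝ :=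
  Real.sqrt (augForm P D δ v v)

/-- The functional `J(v) = c(v, v) / 2 - (ℓ(v) + δ⁻¹ ∑ i, β i |B i| ⨍_{B i} v)`. -/
def energy {d m : ℕ} {Ω : Set (Sp d)} (P : EllipticData Ω) (D : Patches Ω m) (δ : ℝ)
    (β : Fin m → ℝ) (v : H1 Ω) : ℝ :=
  augForm P D δ v v / 2 - (P.ℓ v + δ⁻¹ * D.bData β v)

/-- `uh ∈ Vh` minimizes the functional over the set `Vh`. -/
def IsMinimizer {d m : ℕ} {Ω : Set (Sp d)} (P : EllipticData Ω) (D : Patches Ω m) (δ : ℝ)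
    (β : Fin m → ℝ) (Vh : Set (H1 Ω)) (uh : H1 Ω) : Prop :=
  uh ∈ Vh ∧ ∀ v ∈ Vh, energy P D δ β uh ≤ energy P D δ β v

/-- The constant `Γ = η max {R² M / (π² αMin), δ}`. -/
def gammaConst {d m : ℕ} {Ω : Set (Sp d)} (P : EllipticData Ω) (D : Patches Ω m) (δ : ℝ) : ℝ :=
  D.η * max (D.R ^ 2 * D.M / (Real.pi ^ 2 * P.αMin)) δ

/-- The parameter `δ` is balanced with a factor `θ ∈ (0, 1]` such that `θ⁻¹ ≤ Θ`, i.e.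
`θ R² M / (π² αMin) ≤ δ ≤ θ⁻¹ R² M / (π² αMin)`. -/
def WellBalanced {d m : ℕ} {Ω : Set (Sp d)} (P : EllipticData Ω) (D : Patches Ω m) (δ Θ : ℝ) :
    Prop :=
  ∃ θ ∈ Ioc (0 : ℝ) 1, θ⁻¹ ≤ Θ ∧
    δ ∈ Icc (θ * (D.R ^ 2 * D.M / (Real.pi ^ 2 * P.αMin)))
      (θ⁻¹ * (D.R ^ 2 * D.M / (Real.pi ^ 2 * P.αMin)))

/-- `g ∈ L²(Ω)` represents the functional `F` on `V`: `F(v) = ∫_Ω g v` for all `v ∈ V`. -/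
def Represents {d : ℕ} {Ω : Set (Sp d)} (V : Submodule ℝ (H1 Ω)) (F : H1 Ω → ℝ) (g : L2 Ω) :
    Prop :=
  ∀ v ∈ V, F v = ∫ x in Ω, g x * fn v x

/-- The functional `F` on `V` belongs to `L²(Ω)`. -/
def IsL2Functional {d : ℕ} {Ω : Set (Sp d)} (V : Submodule ℝ (H1 Ω)) (F : H1 Ω → ℝ) : Prop :=
  ∃ g : L2 Ω, Represents V F g

/-- The `L²(Ω)`-norm of a functional `F` on `V` that belongs to `L²(Ω)`, i.e. `‖g‖` for the
representative `g` of `F` (which is unique if `H¹₀(Ω) ⊆ V`, as `H¹₀(Ω)` is dense in `L²(Ω)`). -/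
def functionalL2Norm {d : ℕ} {Ω : Set (Sp d)} (V : Submodule ℝ (H1 Ω)) (F : H1 Ω → ℝ) : ℝ :=
  sInf {t : ℝ | ∃ g : L2 Ω, Represents V F g ∧ t = ‖g‖}

/-- The residual `v ↦ ℓ(v) - a(u, v)`. -/
def pdeResidual {d : ℕ} {Ω : Set (Sp d)} (P : EllipticData Ω) (u v : H1 Ω) : ℝ :=
  P.ℓ v - P.a u v

/-- The data error functional `v ↦ ∑ i, β i |B i| ⨍_{B i} v - b(u, v)`. -/
def dataResidual {d m : ℕ} {Ω : Set (Sp d)} (D : Patches Ω m) (β : Fin m → ℝ) (u v : H1 Ω) : ℝ :=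
  D.bData β v - D.b u v

/-- The PDE error `E_pde = ‖ℓ - a(u, ·)‖_{L²(Ω)}`. -/
def Epde {d : ℕ} {Ω : Set (Sp d)} (P : EllipticData Ω) (V : Submodule ℝ (H1 Ω)) (u : H1 Ω) : ℝ :=
  functionalL2Norm V (pdeResidual P u)

/-- The data error: the `L²(Ω)`-norm of the data error functional. -/
def Edata {d m : ℕ} {Ω : Set (Sp d)} (D : Patches Ω m) (β : Fin m → ℝ)
    (V : Submodule ℝ (H1 Ω)) (u : H1 Ω) : ℝ :=
  functionalL2Norm V (dataResidual D β u)

/-- The approximation error `inf_{v ∈ Vh} (R ‖∇(v - u)‖ + ‖v - u‖)`. -/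
def Eapprox {d m : ℕ} {Ω : Set (Sp d)} (D : Patches Ω m) (Vh : Set (H1 Ω)) (u : H1 Ω) : ℝ :=
  sInf ((fun v : H1 Ω => D.R * ‖grad (v - u)‖ + ‖fn (v - u)‖) '' Vh)

end PDELearning

end

/-!
The constants only have to be uniform, so the sharp Poincaré constant of convex sets can be replaced
by a constant that depends on the dimension and has an elementary proof.

*Local estimate.* For a smooth function `f` on a convex set `U`, write `f x - f y` as an integral of
the gradient along the segment from `y` to `x` and integrate its square over `x, y ∈ U`. At the
parameter `t`, one of the two homotheties centred at `y` and at `x` has ratio at least `1 / 2`, so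
the change of variables costs at most `2 ^ d`. Mollification and Fatou's lemma carry this over to
`H¹(Ω)` for open convex `U ⊆ Ω` (`lintegral_lintegral_enorm_fn_sub_sq_le`): the gradient of the
mollified function is the mollified weak gradient, which Jensen's inequality bounds in `L²`, and the
functions themselves converge almost everywhere. Restricting `y` to a subset `B` of `U` compares the
function with its average over `B`, at the price of the factor `|U| / |B| ≤ η`.

*Norm equivalence.* The sets `interior (K i) ∩ Ω` are open and convex, cover `Ω` up to a null set,
and overlap at most `M` times. Summing the local estimates gives `‖v‖² ≤ c Γ ‖v‖_c²` with `c`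
depending on `d` only (`norm_fn_sq_le_augNorm`). Conversely, if `δ` is balanced then `Γ ≲ R²` and
`Γ δ⁻¹ ≲ 1`, which bounds `√Γ ‖v‖_c` by `R ‖∇v‖ + ‖v‖` (`sqrt_gammaConst_mul_augNorm_le`).

*Minimization.* Up to a constant, the energy of `v` is `‖v - u‖_c² / 2 - ρ(v)`, where `ρ` is
the sum of the residuals `ℓ - a(u, ·)` and `δ⁻¹` times the data error. Comparing a minimizer `uh`
over an arbitrary set with a competitor `v` and bounding `ρ(uh - v)` by the norm equivalence gives
`‖uh - u‖_c ≤ ‖v - u‖_c + 2 κ`, where `κ` is `√(c Γ)` times the `L²`-norm of a representative of `ρ`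
(`augNorm_minimizer_sub_le`). A further use of the norm equivalence yields the `L²`-estimate.
-/

namespace PDELearning

open Filter Topology Metric
open scoped Convolution

/-! ### A Poincaré inequality for smooth functions on convex sets -/

theorem sq_lintegral_le_mul_lintegral_sq {α : Type*} [MeasurableSpace α] (μ : Measure α)
    {f : α → ℝ≥0∞} (hf : AEMeasurable f μ) :
    (∫⁻ a, f a ∂μ) ^ 2 ≤ μ univ * ∫⁻ a, f a ^ 2 ∂μ := by
  have h := ENNReal.lintegral_mul_le_Lp_mul_Lq μ Real.HolderConjugate.two_two hf
    (aemeasurable_const (b := (1 : ℝ≥0∞)))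
  simp only [Pi.mul_apply, mul_one, ENNReal.one_rpow, lintegral_const, one_mul] at h
  calc (∫⁻ a, f a ∂μ) ^ 2
      ≤ ((∫⁻ a, f a ^ (2 : ℝ) ∂μ) ^ (1 / 2 : ℝ) * μ univ ^ (1 / 2 : ℝ)) ^ 2 := by gcongr
    _ = μ univ * ∫⁻ a, f a ^ 2 ∂μ := by
      rw [mul_pow, ← ENNReal.rpow_natCast, ← ENNReal.rpow_natCast, ← ENNReal.rpow_mul,
        ← ENNReal.rpow_mul, mul_comm]
      norm_num

/-- The homothety with centre `y` and ratio `t` contracts volumes by `t ^ d`, so integrating a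
nonnegative function along it costs the factor `t⁻ᵈ ≤ 2 ^ d` if `t ≥ 1 / 2`. -/
theorem setLIntegral_comp_homothety_le {d : ℕ} {U : Set (Sp d)} (hU : Convex ℝ U)
    (hUm : MeasurableSet U) {h : Sp d → ℝ≥0∞} (hh : Measurable h) {y : Sp d} (hy : y ∈ U)
    {t : ℝ} (ht : 1 / 2 ≤ t) (ht1 : t ≤ 1) :
    ∫⁻ x in U, h (y + t • (x - y)) ≤ 2 ^ d * ∫⁻ z in U, h z := by
  have ht0 : t ≠ 0 := by linarith
  have hg : Measurable (U.indicator h) := hh.indicator hUm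
  have hgt : Measurable fun z : Sp d => U.indicator h (y + z) := by fun_prop
  calc ∫⁻ x in U, h (y + t • (x - y))
      = ∫⁻ x in U, U.indicator h (y + t • (x - y)) := by
        refine setLIntegral_congr_fun hUm fun x hx => ?_
        have hmem : y + t • (x - y) ∈ U :=
          hU.add_smul_sub_mem hy hx ⟨by linarith, ht1⟩
        simp only [indicator_of_mem hmem]
    _ ≤ ∫⁻ x, U.indicator h (y + t • (x - y)) := setLIntegral_le_lintegral _ _
    _ = ∫⁻ x, U.indicator h (y + t • x) :=
        lintegral_sub_right_eq_self (fun x => U.indicator h (y + t • x)) y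
    _ = ∫⁻ z, U.indicator h (y + z) ∂(Measure.map (t • ·) volume) :=
        (lintegral_map hgt (measurable_const_smul t)).symm
    _ = ENNReal.ofReal |(t ^ d)⁻¹| * ∫⁻ z, U.indicator h (y + z) := by
        rw [Measure.map_addHaar_smul _ ht0, lintegral_smul_measure]
        simp
    _ = ENNReal.ofReal |(t ^ d)⁻¹| * ∫⁻ z in U, h z := by
        rw [lintegral_add_left_eq_self (fun z => U.indicator h z) y, lintegral_indicator hUm]
    _ ≤ 2 ^ d * ∫⁻ z in U, h z := by
        gcongr
        have h2 : (2 : ℝ≥0∞) ^ d = ENNReal.ofReal (2 ^ d) := by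
          rw [ENNReal.ofReal_pow (by norm_num)]; norm_num
        rw [h2]
        refine ENNReal.ofReal_le_ofReal ?_
        rw [abs_of_pos (by positivity), ← inv_pow]
        refine pow_le_pow_left₀ (by positivity) ?_ d
        rw [inv_le_comm₀ (by linarith) (by norm_num)]
        linarith

/-- The fixed endpoint is `y` if `t ≥ 1 / 2` and `x` otherwise, so that the moving endpoint always
traverses at least half of the segment. -/
theorem setLIntegral_setLIntegral_comp_segment_le {d : ℕ} {U : Set (Sp d)} (hU : Convex ℝ U)
    (hUm : MeasurableSet U) {h : Sp d → ℝ≥0∞} (hh : Measurable h)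
    {t : ℝ} (ht0 : 0 ≤ t) (ht1 : t ≤ 1) :
    ∫⁻ x in U, ∫⁻ y in U, h (y + t • (x - y)) ≤ 2 ^ d * volume U * ∫⁻ z in U, h z := by
  have key : ∀ s : ℝ, 1 / 2 ≤ s → s ≤ 1 →
      ∫⁻ y in U, ∫⁻ x in U, h (y + s • (x - y)) ≤ 2 ^ d * volume U * ∫⁻ z in U, h z := by
    intro s hs hs1
    calc ∫⁻ y in U, ∫⁻ x in U, h (y + s • (x - y))
        ≤ ∫⁻ _ in U, 2 ^ d * ∫⁻ z in U, h z :=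
          setLIntegral_mono' hUm fun y hy => setLIntegral_comp_homothety_le hU hUm hh hy hs hs1
      _ = 2 ^ d * volume U * ∫⁻ z in U, h z := by
          rw [setLIntegral_const]; ring
  rcases le_total (1 / 2) t with ht | ht
  · rw [lintegral_lintegral_swap (by fun_prop)]
    exact key t ht ht1
  -- for `t ≤ 1 / 2` the same point is reached from `x` with ratio `1 - t ≥ 1 / 2`
  · refine le_trans (le_of_eq ?_) (key (1 - t) (by linarith) (by linarith))
    refine lintegral_congr fun x => lintegral_congr fun y => congrArg h ?_
    module

/-- The difference `f x - f y` is the integral of `fderiv ℝ f` along the segment from `y` to `x`. -/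
theorem enorm_sub_sq_le_lintegral_segment {d : ℕ} {f : Sp d → ℝ} (hf : ContDiff ℝ 1 f)
    {R : ℝ} {x y : Sp d} (hR : ‖x - y‖ ≤ R) :
    ‖f x - f y‖ₑ ^ 2
      ≤ ENNReal.ofReal R ^ 2 * ∫⁻ t in Ioc (0 : ℝ) 1, ‖fderiv ℝ f (y + t • (x - y))‖ₑ ^ 2 := by
  have hfc : Continuous (fderiv ℝ f) := hf.continuous_fderiv one_ne_zero
  have hd : ∀ t : ℝ, HasDerivAt (fun t : ℝ => f (y + t • (x - y)))
      (fderiv ℝ f (y + t • (x - y)) (x - y)) t := by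
    intro t
    have h1 : HasDerivAt (fun t : ℝ => y + t • (x - y)) (x - y) t := by
      simpa using ((hasDerivAt_id t).smul_const (x - y)).const_add y
    exact ((hf.differentiable one_ne_zero).differentiableAt.hasFDerivAt).comp_hasDerivAt t h1
  have hc : Continuous fun t : ℝ => fderiv ℝ f (y + t • (x - y)) (x - y) := by fun_prop
  have hint : f x - f y = ∫ t in Ioc (0 : ℝ) 1, fderiv ℝ f (y + t • (x - y)) (x - y) := by
    rw [← intervalIntegral.integral_of_le zero_le_one,
      intervalIntegral.integral_eq_sub_of_hasDerivAt (fun t _ => hd t)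
        (hc.intervalIntegrable _ _)]
    simp
  have hxy : ‖x - y‖ₑ ≤ ENNReal.ofReal R := by
    rw [← ofReal_norm]
    exact ENNReal.ofReal_le_ofReal hR
  have hm : Measurable fun t : ℝ => ‖fderiv ℝ f (y + t • (x - y))‖ₑ := by
    have : Continuous fun t : ℝ => ‖fderiv ℝ f (y + t • (x - y))‖ₑ := by fun_prop
    exact this.measurable
  calc ‖f x - f y‖ₑ ^ 2
      ≤ (∫⁻ t in Ioc (0 : ℝ) 1, ‖fderiv ℝ f (y + t • (x - y)) (x - y)‖ₑ) ^ 2 := by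
        rw [hint]; gcongr; exact enorm_integral_le_lintegral_enorm _
    _ ≤ (∫⁻ t in Ioc (0 : ℝ) 1, ENNReal.ofReal R * ‖fderiv ℝ f (y + t • (x - y))‖ₑ) ^ 2 := by
        gcongr with t
        calc _ ≤ ‖fderiv ℝ f (y + t • (x - y))‖ₑ * ‖x - y‖ₑ :=
              ContinuousLinearMap.le_opENorm _ _
          _ ≤ _ := by rw [mul_comm]; gcongr
    _ = ENNReal.ofReal R ^ 2 * (∫⁻ t in Ioc (0 : ℝ) 1, ‖fderiv ℝ f (y + t • (x - y))‖ₑ) ^ 2 := by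
        rw [lintegral_const_mul _ hm, mul_pow]
    _ ≤ _ := by
        gcongr
        simpa using sq_lintegral_le_mul_lintegral_sq (volume.restrict (Ioc (0 : ℝ) 1))
          hm.aemeasurable

theorem lintegral_lintegral_segment_swap {d : ℕ} (μ : Measure (Sp d)) [SFinite μ] (I : Measure ℝ)
    [SFinite I] {h : Sp d → ℝ≥0∞} (hh : Measurable h) (c : ℝ≥0∞) :
    ∫⁻ x, ∫⁻ y, c * ∫⁻ t, h (y + t • (x - y)) ∂I ∂μ ∂μ
      = c * ∫⁻ t, (∫⁻ x, ∫⁻ y, h (y + t • (x - y)) ∂μ ∂μ) ∂I := by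
  have hmI : Measurable fun p : Sp d × Sp d => ∫⁻ t, h (p.2 + t • (p.1 - p.2)) ∂I := by
    have : Measurable fun p : (Sp d × Sp d) × ℝ => h (p.1.2 + p.2 • (p.1.1 - p.1.2)) := by
      fun_prop
    exact this.lintegral_prod_right'
  have hmμ : Measurable fun p : Sp d × ℝ => ∫⁻ y, h (y + p.2 • (p.1 - y)) ∂μ := by
    have : Measurable fun p : (Sp d × ℝ) × Sp d => h (p.2 + p.1.2 • (p.1.1 - p.2)) := by
      fun_prop
    exact this.lintegral_prod_right'
  have hmx : ∀ x : Sp d, Measurable fun p : Sp d × ℝ => h (p.1 + p.2 • (x - p.1)) := by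
    intro x; fun_prop
  have hmIx : ∀ x : Sp d, Measurable fun y : Sp d => ∫⁻ t, h (y + t • (x - y)) ∂I :=
    fun x => (hmx x).lintegral_prod_right'
  calc ∫⁻ x, ∫⁻ y, c * ∫⁻ t, h (y + t • (x - y)) ∂I ∂μ ∂μ
      = ∫⁻ x, c * ∫⁻ y, ∫⁻ t, h (y + t • (x - y)) ∂I ∂μ ∂μ :=
        lintegral_congr fun x => lintegral_const_mul _ (hmIx x)
    _ = c * ∫⁻ x, ∫⁻ y, ∫⁻ t, h (y + t • (x - y)) ∂I ∂μ ∂μ :=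
        lintegral_const_mul _ hmI.lintegral_prod_right'
    _ = c * ∫⁻ x, ∫⁻ t, (∫⁻ y, h (y + t • (x - y)) ∂μ) ∂I ∂μ := by
        congr 1
        exact lintegral_congr fun x => lintegral_lintegral_swap (hmx x).aemeasurable
    _ = _ := by
        congr 1
        exact lintegral_lintegral_swap hmμ.aemeasurable

/-- A Poincaré inequality for smooth functions on a convex set, in terms of the mean squared
difference of the values. -/
theorem lintegral_lintegral_enorm_sub_sq_le_of_contDiff {d : ℕ} {U : Set (Sp d)}
    (hU : Convex ℝ U) (hUm : MeasurableSet U) {R : ℝ}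
    (hR : ∀ x ∈ U, ∀ y ∈ U, ‖x - y‖ ≤ R) {f : Sp d → ℝ} (hf : ContDiff ℝ 1 f) :
    ∫⁻ x in U, ∫⁻ y in U, ‖f x - f y‖ₑ ^ 2
      ≤ ENNReal.ofReal R ^ 2 * (2 ^ d * volume U * ∫⁻ z in U, ‖fderiv ℝ f z‖ₑ ^ 2) := by
  obtain ⟨h, hh⟩ : ∃ h : Sp d → ℝ≥0∞, h = fun z => ‖fderiv ℝ f z‖ₑ ^ 2 := ⟨_, rfl⟩
  have hhm : Measurable h := by
    have hfc : Continuous (fderiv ℝ f) := hf.continuous_fderiv one_ne_zero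
    have : Continuous h := by rw [hh]; fun_prop
    exact this.measurable
  have pointwise : ∀ x ∈ U, ∀ y ∈ U, ‖f x - f y‖ₑ ^ 2
      ≤ ENNReal.ofReal R ^ 2 * ∫⁻ t in Ioc (0 : ℝ) 1, h (y + t • (x - y)) := by
    intro x hx y hy
    rw [hh]
    exact enorm_sub_sq_le_lintegral_segment hf (hR x hx y hy)
  have hsum : ∫⁻ z in U, ‖fderiv ℝ f z‖ₑ ^ 2 = ∫⁻ z in U, h z := by rw [hh]
  rw [hsum]
  calc ∫⁻ x in U, ∫⁻ y in U, ‖f x - f y‖ₑ ^ 2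
      ≤ ∫⁻ x in U, ∫⁻ y in U,
          ENNReal.ofReal R ^ 2 * ∫⁻ t in Ioc (0 : ℝ) 1, h (y + t • (x - y)) :=
        setLIntegral_mono' hUm fun x hx => setLIntegral_mono' hUm fun y hy =>
          pointwise x hx y hy
    _ = ENNReal.ofReal R ^ 2 * ∫⁻ t in Ioc (0 : ℝ) 1,
          ∫⁻ x in U, ∫⁻ y in U, h (y + t • (x - y)) :=
        lintegral_lintegral_segment_swap (volume.restrict U) _ hhm _
    _ ≤ ENNReal.ofReal R ^ 2 * ∫⁻ _ in Ioc (0 : ℝ) 1, (2 ^ d * volume U * ∫⁻ z in U, h z) := by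
        gcongr ENNReal.ofReal R ^ 2 * ?_
        exact setLIntegral_mono' measurableSet_Ioc fun t ht =>
          setLIntegral_setLIntegral_comp_segment_le hU hUm hhm ht.1.le ht.2
    _ = _ := by simp

/-! ### Mollification of Sobolev functions -/

/-- The extension of a Sobolev function by zero outside of `Ω`. -/
noncomputable def zeroExt {d : ℕ} {Ω : Set (Sp d)} (v : H1 Ω) : Sp d → ℝ := Ω.indicator (fn v)

/-- The mollification of a Sobolev function, extended by zero, with a bump function. -/
noncomputable def mollify {d : ℕ} {Ω : Set (Sp d)} (φ : ContDiffBump (0 : Sp d)) (v : H1 Ω) :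
    Sp d → ℝ :=
  φ.normed volume ⋆[ContinuousLinearMap.lsmul ℝ ℝ, volume] zeroExt v

theorem locallyIntegrable_zeroExt {d : ℕ} {Ω : Set (Sp d)} (hΩ : IsOpen Ω)
    (hb : Bornology.IsBounded Ω) (v : H1 Ω) : LocallyIntegrable (zeroExt v) := by
  have : IsFiniteMeasure (volume.restrict Ω) :=
    ⟨by simpa using hb.measure_lt_top⟩
  have h : IntegrableOn (fn v) Ω := (Lp.memLp (fn v)).integrable (by norm_num)
  exact (h.integrable_indicator hΩ.measurableSet).locallyIntegrable

theorem contDiff_mollify {d : ℕ} {Ω : Set (Sp d)} (hΩ : IsOpen Ω)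
    (hb : Bornology.IsBounded Ω) (φ : ContDiffBump (0 : Sp d)) (v : H1 Ω) :
    ContDiff ℝ 1 (mollify φ v) :=
  φ.hasCompactSupport_normed.contDiff_convolution_left (n := 1) _ φ.contDiff_normed
    (locallyIntegrable_zeroExt hΩ hb v)

/-- The function `y ↦ ψ (x - y)` is admissible in the integration by parts formula as soon as the
closed ball around `x` that contains its support lies in `Ω`. -/
theorem isTestFunction_normed_sub {d : ℕ} {Ω : Set (Sp d)} (φ : ContDiffBump (0 : Sp d))
    {x : Sp d} (hx : closedBall x φ.rOut ⊆ Ω) :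
    IsTestFunction Ω (fun y => φ.normed volume (x - y)) := by
  have hts : tsupport (fun y => φ.normed volume (x - y)) ⊆ closedBall x φ.rOut := by
    refine closure_minimal (fun y hy => ?_) isClosed_closedBall
    have : x - y ∈ Function.support (φ.normed volume) := hy
    rw [φ.support_normed_eq, mem_ball_zero_iff] at this
    rw [mem_closedBall, dist_comm, dist_eq_norm]
    exact this.le
  refine ⟨?_, ?_, hts.trans hx⟩
  · exact φ.contDiff_normed.comp (contDiff_const.sub contDiff_id)
  · exact (isCompact_closedBall x φ.rOut).of_isClosed_subset (isClosed_tsupport _) hts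

/-- The gradient of the mollification is the mollification of the weak gradient. -/
theorem fderiv_mollify_apply {d : ℕ} {Ω : Set (Sp d)} (hΩ : IsOpen Ω)
    (hb : Bornology.IsBounded Ω) (φ : ContDiffBump (0 : Sp d)) (v : H1 Ω) {x : Sp d}
    (hx : closedBall x φ.rOut ⊆ Ω) (e : Sp d) :
    fderiv ℝ (mollify φ v) x e = ∫ y in Ω, inner ℝ (grad v y) e * φ.normed volume (x - y) := by
  have hv : IsWeakGradient Ω (fn v) (grad v) := v.2
  have hloc := locallyIntegrable_zeroExt hΩ hb v
  have hsm : ContDiff ℝ 1 (φ.normed (volume : Measure (Sp d))) := φ.contDiff_normed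
  have hcs := φ.hasCompactSupport_normed (μ := (volume : Measure (Sp d)))
  have hd := hcs.hasFDerivAt_convolution_left (ContinuousLinearMap.lsmul ℝ ℝ) hsm hloc x
  have hconv : Integrable (fun y =>
      ((ContinuousLinearMap.lsmul ℝ ℝ).precompL (Sp d))
        (fderiv ℝ (φ.normed volume) (x - y)) (zeroExt v y)) := by
    have := (hcs.fderiv ℝ).convolutionExists_left
      ((ContinuousLinearMap.lsmul ℝ ℝ : ℝ →L[ℝ] ℝ →L[ℝ] ℝ).precompL (Sp d))
      (hsm.continuous_fderiv one_ne_zero) hloc x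
    exact ((convolutionExistsAt_iff_integrable_swap (μ := volume)).1 this)
  have hfd : ∀ y, fderiv ℝ (fun y => φ.normed volume (x - y)) y e
      = - fderiv ℝ (φ.normed volume) (x - y) e := by
    intro y
    have h1 : HasFDerivAt (fun y : Sp d => x - y) (-ContinuousLinearMap.id ℝ (Sp d)) y :=
      (hasFDerivAt_id y).const_sub x
    have h2 := ((hsm.differentiable one_ne_zero).differentiableAt (x := x - y)).hasFDerivAt.comp y h1
    have h3 := h2.fderiv
    rw [show (fun y => φ.normed volume (x - y)) = φ.normed volume ∘ fun y => x - y from rfl, h3]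
    simp
  have hibp := hv _ (isTestFunction_normed_sub φ hx) e
  calc fderiv ℝ (mollify φ v) x e
      = (∫ y, ((ContinuousLinearMap.lsmul ℝ ℝ).precompL (Sp d))
        (fderiv ℝ (φ.normed volume) (x - y)) (zeroExt v y)) e := by
        rw [mollify, hd.fderiv, convolution_eq_swap]
    _ = ∫ y, fderiv ℝ (φ.normed volume) (x - y) e * zeroExt v y := by
        rw [ContinuousLinearMap.integral_apply hconv]
        simp [ContinuousLinearMap.precompL_apply]
    _ = ∫ y in Ω, fn v y * fderiv ℝ (φ.normed volume) (x - y) e := by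
        rw [← integral_indicator hΩ.measurableSet]
        refine integral_congr_ae (ae_of_all _ fun y => ?_)
        by_cases hy : y ∈ Ω <;> simp [zeroExt, hy, mul_comm]
    _ = - ∫ y in Ω, fn v y * fderiv ℝ (fun y => φ.normed volume (x - y)) y e := by
        rw [← integral_neg]
        simp_rw [hfd, mul_neg, neg_neg]
    _ = _ := by rw [hibp, neg_neg]

/-- By Jensen's inequality, the squared gradient of the mollification is at most the mollification
of the squared gradient. -/
theorem enorm_fderiv_mollify_sq_le {d : ℕ} {Ω U : Set (Sp d)} (hΩ : IsOpen Ω)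
    (hb : Bornology.IsBounded Ω) (hU : MeasurableSet U) (hUΩ : U ⊆ Ω)
    (φ : ContDiffBump (0 : Sp d)) (v : H1 Ω) {x : Sp d} (hx : closedBall x φ.rOut ⊆ U) :
    ‖fderiv ℝ (mollify φ v) x‖ₑ ^ 2
      ≤ ∫⁻ y in U, ‖φ.normed volume (x - y)‖ₑ * ‖grad v y‖ₑ ^ 2 := by
  set w : Sp d → ℝ≥0∞ := fun y => ‖φ.normed volume (x - y)‖ₑ with hw
  have hwc : Continuous w := by
    have := φ.continuous_normed (μ := (volume : Measure (Sp d)))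
    fun_prop
  have hw1 : ∫⁻ y, w y = 1 := by
    have h1 : ∫⁻ y, w y = ∫⁻ y, ‖φ.normed (volume : Measure (Sp d)) y‖ₑ :=
      lintegral_sub_left_eq_self (fun y => ‖φ.normed (volume : Measure (Sp d)) y‖ₑ) x
    rw [h1]
    simp_rw [Real.enorm_of_nonneg (φ.nonneg_normed _)]
    rw [← ofReal_integral_eq_lintegral_ofReal φ.integrable_normed
      (ae_of_all _ φ.nonneg_normed), φ.integral_normed, ENNReal.ofReal_one]
  have hwU : ∀ y, y ∉ U → w y = 0 := by
    intro y hy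
    have : x - y ∉ Function.support (φ.normed (volume : Measure (Sp d))) := by
      rw [φ.support_normed_eq, mem_ball_zero_iff]
      intro h
      refine hy (hx ?_)
      rw [mem_closedBall, dist_comm, dist_eq_norm]
      exact h.le
    simp [hw, Function.notMem_support.1 this]
  have hG : AEStronglyMeasurable (grad v) (volume.restrict Ω) := (Lp.memLp (grad v)).1
  have hGU : AEMeasurable (fun y => ‖grad v y‖ₑ) (volume.restrict U) :=
    (hG.mono_measure (Measure.restrict_mono hUΩ le_rfl)).enorm
  have hred : ∫⁻ y in Ω, w y * ‖grad v y‖ₑ = ∫⁻ y in U, w y * ‖grad v y‖ₑ := by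
    rw [← lintegral_indicator hΩ.measurableSet, ← lintegral_indicator hU]
    refine lintegral_congr fun y => ?_
    by_cases hy : y ∈ U
    · simp [hy, hUΩ hy]
    · simp [hy, hwU y hy, indicator]
  have hop : ‖fderiv ℝ (mollify φ v) x‖ₑ ≤ ∫⁻ y in U, w y * ‖grad v y‖ₑ := by
    by_cases htop : ∫⁻ y in U, w y * ‖grad v y‖ₑ = ⊤
    · rw [htop]; exact le_top
    rw [← ofReal_norm]
    refine ENNReal.ofReal_le_of_le_toReal ?_
    refine ContinuousLinearMap.opNorm_le_bound _ ENNReal.toReal_nonneg fun e => ?_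
    have he : ‖fderiv ℝ (mollify φ v) x e‖ₑ ≤ (∫⁻ y in U, w y * ‖grad v y‖ₑ) * ‖e‖ₑ := by
      rw [fderiv_mollify_apply hΩ hb φ v (hx.trans hUΩ) e, ← hred]
      refine (enorm_integral_le_lintegral_enorm _).trans ?_
      rw [← lintegral_mul_const' _ _ enorm_ne_top]
      refine lintegral_mono fun y => ?_
      rw [enorm_mul, mul_comm, mul_assoc]
      gcongr
      rw [← ofReal_norm, ← ofReal_norm (grad v y), ← ofReal_norm e,
        ← ENNReal.ofReal_mul (norm_nonneg _)]
      exact ENNReal.ofReal_le_ofReal (norm_inner_le_norm _ _)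
    have := ENNReal.toReal_mono (ENNReal.mul_ne_top htop enorm_ne_top) he
    simpa [ENNReal.toReal_mul] using this
  have hwae : AEMeasurable w (volume.restrict U) := hwc.measurable.aemeasurable
  -- the weight has mass at most one on `U`, so Jensen's inequality applies to the measure `w dy`
  set ν : Measure (Sp d) := (volume.restrict U).withDensity w with hν
  have hν1 : ν univ ≤ 1 := by
    rw [hν, withDensity_apply _ MeasurableSet.univ, Measure.restrict_univ, ← hw1]
    exact setLIntegral_le_lintegral _ _
  have hGν : AEMeasurable (fun y => ‖grad v y‖ₑ) ν := hGU.mono_ac (withDensity_absolutelyContinuous _ _)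
  calc ‖fderiv ℝ (mollify φ v) x‖ₑ ^ 2
      ≤ (∫⁻ y in U, w y * ‖grad v y‖ₑ) ^ 2 := by gcongr
    _ = (∫⁻ y, ‖grad v y‖ₑ ∂ν) ^ 2 := by
        rw [hν, lintegral_withDensity_eq_lintegral_mul₀ hwae hGU]; rfl
    _ ≤ ν univ * ∫⁻ y, ‖grad v y‖ₑ ^ 2 ∂ν := sq_lintegral_le_mul_lintegral_sq ν hGν
    _ ≤ 1 * ∫⁻ y, ‖grad v y‖ₑ ^ 2 ∂ν := by gcongr
    _ = ∫⁻ y in U, w y * ‖grad v y‖ₑ ^ 2 := by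
        rw [one_mul, hν, lintegral_withDensity_eq_lintegral_mul₀ hwae (hGU.pow_const 2)]; rfl

theorem lintegral_enorm_fderiv_mollify_sq_le {d : ℕ} {Ω U S : Set (Sp d)} (hΩ : IsOpen Ω)
    (hb : Bornology.IsBounded Ω) (hU : MeasurableSet U) (hUΩ : U ⊆ Ω) (hS : MeasurableSet S)
    (φ : ContDiffBump (0 : Sp d)) (v : H1 Ω) (hx : ∀ x ∈ S, closedBall x φ.rOut ⊆ U) :
    ∫⁻ x in S, ‖fderiv ℝ (mollify φ v) x‖ₑ ^ 2 ≤ ∫⁻ y in U, ‖grad v y‖ₑ ^ 2 := by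
  have hφc := φ.continuous_normed (μ := (volume : Measure (Sp d)))
  have hG : AEStronglyMeasurable (grad v) (volume.restrict U) :=
    (Lp.memLp (grad v)).1.mono_measure (Measure.restrict_mono hUΩ le_rfl)
  have hGm : AEMeasurable (fun y => ‖grad v y‖ₑ ^ 2) (volume.restrict U) := hG.enorm.pow_const 2
  calc ∫⁻ x in S, ‖fderiv ℝ (mollify φ v) x‖ₑ ^ 2
      ≤ ∫⁻ x in S, ∫⁻ y in U, ‖φ.normed volume (x - y)‖ₑ * ‖grad v y‖ₑ ^ 2 :=
        setLIntegral_mono' hS fun x hxS =>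
          enorm_fderiv_mollify_sq_le hΩ hb hU hUΩ φ v (hx x hxS)
    _ = ∫⁻ y in U, ∫⁻ x in S, ‖φ.normed volume (x - y)‖ₑ * ‖grad v y‖ₑ ^ 2 := by
        refine lintegral_lintegral_swap ?_
        have h1 : Measurable fun p : Sp d × Sp d => ‖φ.normed volume (p.1 - p.2)‖ₑ := by
          have : Continuous fun p : Sp d × Sp d => ‖φ.normed volume (p.1 - p.2)‖ₑ := by fun_prop
          exact this.measurable
        exact h1.aemeasurable.mul (hGm.comp_quasiMeasurePreserving Measure.quasiMeasurePreserving_snd)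
    _ ≤ ∫⁻ y in U, ‖grad v y‖ₑ ^ 2 := by
        refine lintegral_mono fun y => ?_
        have hc : Measurable fun x => ‖φ.normed volume (x - y)‖ₑ := by
          have : Continuous fun x => ‖φ.normed volume (x - y)‖ₑ := by fun_prop
          exact this.measurable
        dsimp only
        rw [lintegral_mul_const _ hc]
        refine mul_le_of_le_one_left' ?_
        refine (setLIntegral_le_lintegral _ _).trans (le_of_eq ?_)
        rw [lintegral_sub_right_eq_self (fun x => ‖φ.normed (volume : Measure (Sp d)) x‖ₑ) y]
        simp_rw [Real.enorm_of_nonneg (φ.nonneg_normed _)]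
        rw [← ofReal_integral_eq_lintegral_ofReal φ.integrable_normed
          (ae_of_all _ φ.nonneg_normed), φ.integral_normed, ENNReal.ofReal_one]

/-! ### A Poincaré inequality for Sobolev functions on convex sets -/

/-- The points whose ball of radius `r` lies in the convex set `U` form a convex set. -/
theorem convex_compl_thickening_compl {d : ℕ} {U : Set (Sp d)} (hU : Convex ℝ U) (r : ℝ) :
    Convex ℝ (thickening r Uᶜ)ᶜ := by
  have hmem : ∀ x, x ∈ (thickening r Uᶜ)ᶜ ↔ ∀ w : Sp d, ‖w‖ < r → x + w ∈ U := by
    intro x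
    rw [mem_compl_iff, mem_thickening_iff]
    constructor
    · intro h w hw
      by_contra hxw
      exact h ⟨x + w, hxw, by simpa using hw⟩
    · rintro h ⟨z, hz, hxz⟩
      refine hz ?_
      have := h (z - x) (by rwa [← dist_eq_norm, dist_comm])
      simpa using this
  intro x hx y hy a b ha hb hab
  rw [hmem] at hx hy ⊢
  intro w hw
  have : a • x + b • y + w = a • (x + w) + b • (y + w) := by
    rw [smul_add, smul_add, add_add_add_comm, ← add_smul, hab, one_smul]
  rw [this]
  exact hU (hx w hw) (hy w hw) ha hb hab

theorem closedBall_subset_of_mem_compl_thickening {d : ℕ} {U : Set (Sp d)} {r s : ℝ} (hrs : s < r)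
    {x : Sp d} (hx : x ∈ (thickening r Uᶜ)ᶜ) : closedBall x s ⊆ U := by
  intro z hz
  by_contra hzU
  exact hx (mem_thickening_iff.2 ⟨z, hzU, by rw [dist_comm]; exact lt_of_le_of_lt hz hrs⟩)

/-- A Poincaré inequality for Sobolev functions on an open convex subset `U` of `Ω`. The
mollifications of `v` satisfy it on the points of `U` that are not too close to the boundary, and
Fatou's lemma removes the mollification. -/
theorem lintegral_lintegral_enorm_fn_sub_sq_le {d : ℕ} {Ω U : Set (Sp d)} (hΩ : IsOpen Ω)
    (hb : Bornology.IsBounded Ω) (hUo : IsOpen U) (hU : Convex ℝ U) (hUΩ : U ⊆ Ω) {R : ℝ}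
    (hR : ∀ x ∈ U, ∀ y ∈ U, ‖x - y‖ ≤ R) (v : H1 Ω) :
    ∫⁻ x in U, ∫⁻ y in U, ‖fn v x - fn v y‖ₑ ^ 2
      ≤ ENNReal.ofReal R ^ 2 * (2 ^ d * volume U * ∫⁻ z in U, ‖grad v z‖ₑ ^ 2) := by
  set bd : ℝ≥0∞ := ENNReal.ofReal R ^ 2 * (2 ^ d * volume U * ∫⁻ z in U, ‖grad v z‖ₑ ^ 2) with hbd
  let φ : ℕ → ContDiffBump (0 : Sp d) := fun n =>
    ⟨1 / (n + 1) / 2, 1 / (n + 1), by positivity, half_lt_self (by positivity)⟩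
  let S : ℕ → Set (Sp d) := fun n => (thickening (2 * (1 / ((n : ℝ) + 1))) Uᶜ)ᶜ
  have hr : Tendsto (fun n : ℕ => 1 / ((n : ℝ) + 1)) atTop (𝓝 0) :=
    tendsto_one_div_add_atTop_nhds_zero_nat
  -- the radius exceeds the support radius of the bump function, so the closed support fits into `U`
  have hSm : ∀ n, MeasurableSet (S n) := fun n => isOpen_thickening.measurableSet.compl
  have hSball : ∀ n, ∀ x ∈ S n, closedBall x (φ n).rOut ⊆ U := fun n x hx =>
    closedBall_subset_of_mem_compl_thickening
      (by change 1 / ((n : ℝ) + 1) < _; have : 0 < 1 / ((n : ℝ) + 1) := by positivity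
          linarith) hx
  have hSU : ∀ n, S n ⊆ U := fun n x hx =>
    hSball n x hx (mem_closedBall_self (φ n).rOut_pos.le)
  have hSev : ∀ x ∈ U, ∀ᶠ n in atTop, x ∈ S n := by
    intro x hx
    obtain ⟨ε, hε, hxε⟩ := Metric.isOpen_iff.1 hUo x hx
    have h2 : Tendsto (fun n : ℕ => 2 * (1 / ((n : ℝ) + 1))) atTop (𝓝 0) := by
      simpa using hr.const_mul 2
    filter_upwards [h2.eventually_lt_const hε] with n hn hxn
    obtain ⟨z, hz, hxz⟩ := mem_thickening_iff.1 hxn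
    exact hz (hxε (by rw [mem_ball, dist_comm]; exact hxz.trans hn))
  let F : ℕ → Sp d × Sp d → ℝ≥0∞ := fun n => (S n ×ˢ S n).indicator
    fun p => ‖mollify (φ n) v p.1 - mollify (φ n) v p.2‖ₑ ^ 2
  have hFc : ∀ n, Measurable fun p : Sp d × Sp d =>
      ‖mollify (φ n) v p.1 - mollify (φ n) v p.2‖ₑ ^ 2 := by
    intro n
    have hc : Continuous (mollify (φ n) v) := (contDiff_mollify hΩ hb (φ n) v).continuous
    have : Continuous fun p : Sp d × Sp d =>
        ‖mollify (φ n) v p.1 - mollify (φ n) v p.2‖ₑ ^ 2 := by fun_prop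
    exact this.measurable
  have hFm : ∀ n, Measurable (F n) := fun n => (hFc n).indicator ((hSm n).prod (hSm n))
  set μ : Measure (Sp d × Sp d) := (volume.restrict U).prod (volume.restrict U) with hμ
  have hFint : ∀ n, ∫⁻ p, F n p ∂μ ≤ bd := by
    intro n
    calc ∫⁻ p, F n p ∂μ
        ≤ ∫⁻ p, F n p ∂((volume : Measure (Sp d)).prod volume) := by
          refine lintegral_mono' ?_ le_rfl
          rw [hμ, Measure.prod_restrict]
          exact Measure.restrict_le_self
      _ = ∫⁻ x in S n, ∫⁻ y in S n, ‖mollify (φ n) v x - mollify (φ n) v y‖ₑ ^ 2 := by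
          rw [lintegral_indicator ((hSm n).prod (hSm n)), ← Measure.prod_restrict,
            lintegral_prod _ (hFc n).aemeasurable]
      _ ≤ ENNReal.ofReal R ^ 2 *
            (2 ^ d * volume (S n) * ∫⁻ z in S n, ‖fderiv ℝ (mollify (φ n) v) z‖ₑ ^ 2) :=
          lintegral_lintegral_enorm_sub_sq_le_of_contDiff (convex_compl_thickening_compl hU _)
            (hSm n) (fun x hx y hy => hR x (hSU n hx) y (hSU n hy)) (contDiff_mollify hΩ hb (φ n) v)
      _ ≤ bd := by
          rw [hbd]
          gcongr ENNReal.ofReal R ^ 2 * (2 ^ d * ?_ * ?_)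
          · exact measure_mono (hSU n)
          · exact lintegral_enorm_fderiv_mollify_sq_le hΩ hb hUo.measurableSet hUΩ (hSm n)
              (φ n) v (hSball n)
  have hae : ∀ᵐ x ∂(volume.restrict U),
      x ∈ U ∧ Tendsto (fun n => mollify (φ n) v x) atTop (𝓝 (fn v x)) := by
    have h1 := ContDiffBump.ae_convolution_tendsto_right_of_locallyIntegrable (φ := φ) (K := 2)
      (μ := volume) hr (Eventually.of_forall fun n => by
        change 1 / ((n : ℝ) + 1) ≤ 2 * (1 / ((n : ℝ) + 1) / 2); linarith)
      (locallyIntegrable_zeroExt hΩ hb v)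
    filter_upwards [ae_restrict_mem hUo.measurableSet, ae_restrict_of_ae h1] with x hxU hx
    refine ⟨hxU, ?_⟩
    have : zeroExt v x = fn v x := indicator_of_mem (hUΩ hxU) _
    rw [← this]
    exact hx
  have hlim : ∀ᵐ p ∂μ, ‖fn v p.1 - fn v p.2‖ₑ ^ 2 = liminf (fun n => F n p) atTop := by
    filter_upwards [Measure.quasiMeasurePreserving_fst.ae hae,
      Measure.quasiMeasurePreserving_snd.ae hae] with p hp1 hp2
    refine (Tendsto.liminf_eq ?_).symm
    have h1 : Tendsto (fun n => ‖mollify (φ n) v p.1 - mollify (φ n) v p.2‖ₑ ^ 2) atTop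
        (𝓝 (‖fn v p.1 - fn v p.2‖ₑ ^ 2)) :=
      ((ENNReal.continuous_pow 2).tendsto _).comp
        ((continuous_enorm.tendsto _).comp (hp1.2.sub hp2.2))
    refine h1.congr' ?_
    filter_upwards [hSev _ hp1.1, hSev _ hp2.1] with n hn1 hn2
    have hmem : p ∈ S n ×ˢ S n := ⟨hn1, hn2⟩
    simp only [F, indicator_of_mem hmem]
  have hvm : Measurable (fn v) := (Lp.stronglyMeasurable (fn v)).measurable
  calc ∫⁻ x in U, ∫⁻ y in U, ‖fn v x - fn v y‖ₑ ^ 2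
      = ∫⁻ p, ‖fn v p.1 - fn v p.2‖ₑ ^ 2 ∂μ := by
        rw [hμ, lintegral_prod _ (by fun_prop)]
    _ = ∫⁻ p, liminf (fun n => F n p) atTop ∂μ := lintegral_congr_ae hlim
    _ ≤ liminf (fun n => ∫⁻ p, F n p ∂μ) atTop := lintegral_liminf_le hFm
    _ ≤ bd := liminf_le_of_le (by isBoundedDefault) fun b hb =>
        let ⟨n, hn⟩ := hb.exists; hn.trans (hFint n)

/-! ### Local averages and overlapping patches -/

theorem lintegral_enorm_sq_eq_ofReal {α E : Type*} [MeasurableSpace α] [NormedAddCommGroup E]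
    {μ : Measure α} {g : α → E} (hg : MemLp g 2 μ) :
    ∫⁻ x, ‖g x‖ₑ ^ 2 ∂μ = ENNReal.ofReal (∫ x, ‖g x‖ ^ 2 ∂μ) := by
  rw [ofReal_integral_eq_lintegral_ofReal hg.norm.integrable_sq
    (ae_of_all _ fun x => by positivity)]
  refine lintegral_congr fun x => ?_
  rw [ENNReal.ofReal_pow (norm_nonneg _), ofReal_norm]

theorem volumeReal_mul_average {d : ℕ} {B : Set (Sp d)} (hB : 0 < volume.real B)
    (f : Sp d → ℝ) : volume.real B * ⨍ x in B, f x = ∫ x in B, f x := by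
  rw [setAverage_eq, smul_eq_mul, mul_inv_cancel_left₀ hB.ne']

theorem volumeReal_mul_average_sq_le {d : ℕ} {B : Set (Sp d)} (hB : 0 < volume.real B)
    {f : Sp d → ℝ} (hf : MemLp f 2 (volume.restrict B)) :
    volume.real B * (⨍ x in B, f x) ^ 2 ≤ ∫ x in B, f x ^ 2 := by
  have hfin : volume B ≠ ⊤ := fun h => by simp [Measure.real, h] at hB
  have : IsFiniteMeasure (volume.restrict B) := ⟨by simpa using hfin.lt_top⟩
  have hfi : Integrable f (volume.restrict B) := hf.integrable (by norm_num)
  set a := ⨍ x in B, f x with ha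
  have hint : ∫ x in B, f x = volume.real B * a := (volumeReal_mul_average hB f).symm
  have h0 : 0 ≤ ∫ x in B, (f x - a) ^ 2 := integral_nonneg fun x => sq_nonneg _
  have h1 : ∫ x in B, (f x - a) ^ 2 = (∫ x in B, f x ^ 2) - 2 * a * (∫ x in B, f x)
      + volume.real B * a ^ 2 := by
    have : ∀ x, (f x - a) ^ 2 = f x ^ 2 - 2 * a * f x + a ^ 2 := fun x => by ring
    simp_rw [this]
    have hsub : Integrable (fun x => f x ^ 2 - 2 * a * f x) (volume.restrict B) :=
      hf.integrable_sq.sub (hfi.const_mul _)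
    rw [integral_add hsub (integrable_const _),
      integral_sub hf.integrable_sq (hfi.const_mul _), integral_const_mul]
    simp
  rw [h1, hint] at h0
  nlinarith

/-- Integrating the difference `f x - f y` over `y ∈ B` compares `f x` with its average. -/
theorem volume_mul_enorm_sub_average_sq_le {d : ℕ} {B : Set (Sp d)} (hB : 0 < volume.real B)
    {f : Sp d → ℝ} (hf : MemLp f 2 (volume.restrict B)) (c : ℝ) :
    volume B * ‖c - ⨍ y in B, f y‖ₑ ^ 2 ≤ ∫⁻ y in B, ‖c - f y‖ₑ ^ 2 := by
  have hfin : volume B ≠ ⊤ := fun h => by simp [Measure.real, h] at hB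
  have : IsFiniteMeasure (volume.restrict B) := ⟨by simpa using hfin.lt_top⟩
  have hcf : MemLp (fun y => c - f y) 2 (volume.restrict B) := (memLp_const c).sub hf
  have hav : c - ⨍ y in B, f y = ⨍ y in B, (c - f y) := by
    have h1 := volumeReal_mul_average hB f
    have h2 := volumeReal_mul_average hB fun y => c - f y
    rw [integral_sub (integrable_const _) (hf.integrable (by norm_num)), ← h1] at h2
    simp only [integral_const, measureReal_restrict_apply_univ, smul_eq_mul] at h2
    refine mul_left_cancel₀ hB.ne' ?_
    rw [h2]; ring
  rw [hav, lintegral_enorm_sq_eq_ofReal hcf, ← ofReal_measureReal hfin, ← ofReal_norm,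
    ← ENNReal.ofReal_pow (norm_nonneg _), ← ENNReal.ofReal_mul measureReal_nonneg]
  refine ENNReal.ofReal_le_ofReal ?_
  simpa using volumeReal_mul_average_sq_le hB hcf

theorem memLp_fn_restrict {d : ℕ} {Ω U : Set (Sp d)} (hUΩ : U ⊆ Ω) (v : H1 Ω) :
    MemLp (fn v) 2 (volume.restrict U) :=
  (Lp.memLp (fn v)).mono_measure (Measure.restrict_mono hUΩ le_rfl)

theorem memLp_grad_restrict {d : ℕ} {Ω U : Set (Sp d)} (hUΩ : U ⊆ Ω) (v : H1 Ω) :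
    MemLp (grad v) 2 (volume.restrict U) :=
  (Lp.memLp (grad v)).mono_measure (Measure.restrict_mono hUΩ le_rfl)

theorem norm_sq_eq_integral {α E : Type*} [MeasurableSpace α] [NormedAddCommGroup E]
    [InnerProductSpace ℝ E] {μ : Measure α} (g : Lp E 2 μ) : ‖g‖ ^ 2 = ∫ x, ‖g x‖ ^ 2 ∂μ := by
  rw [← real_inner_self_eq_norm_sq, L2.inner_def]
  simp

theorem norm_fn_sq {d : ℕ} {Ω : Set (Sp d)} (v : H1 Ω) :
    ‖fn v‖ ^ 2 = ∫ x in Ω, fn v x ^ 2 := by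
  rw [norm_sq_eq_integral]; simp

theorem integrable_fn_sq {d : ℕ} {Ω : Set (Sp d)} (v : H1 Ω) :
    IntegrableOn (fun x => fn v x ^ 2) Ω := (Lp.memLp (fn v)).integrable_sq

theorem integrable_norm_grad_sq {d : ℕ} {Ω : Set (Sp d)} (v : H1 Ω) :
    IntegrableOn (fun x => ‖grad v x‖ ^ 2) Ω := (Lp.memLp (grad v)).norm.integrable_sq

/-- The local estimate behind the norm equivalence: on a convex set `U`, a Sobolev function is
controlled by its gradient and its average over a subset `B` that is not too small. -/
theorem integral_fn_sq_le_of_convex {d : ℕ} {Ω U B : Set (Sp d)} (hΩ : IsOpen Ω)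
    (hb : Bornology.IsBounded Ω) (hUo : IsOpen U) (hU : Convex ℝ U) (hUΩ : U ⊆ Ω) (hBU : B ⊆ U)
    {R η : ℝ} (hR0 : 0 ≤ R) (hR : ∀ x ∈ U, ∀ y ∈ U, ‖x - y‖ ≤ R) (hB : 0 < volume.real B)
    (hη : volume.real U ≤ η * volume.real B) (v : H1 Ω) :
    ∫ x in U, fn v x ^ 2 ≤ 2 * η * 2 ^ d * R ^ 2 * (∫ x in U, ‖grad v x‖ ^ 2)
      + 2 * η * (volume.real B * (⨍ x in B, fn v x) * (⨍ x in B, fn v x)) := by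
  have hUfin : volume U ≠ ⊤ := ((hb.subset hUΩ).measure_lt_top).ne
  have hBfin : volume B ≠ ⊤ := ((hb.subset (hBU.trans hUΩ)).measure_lt_top).ne
  have : IsFiniteMeasure (volume.restrict U) := ⟨by simpa using hUfin.lt_top⟩
  have hvU := memLp_fn_restrict hUΩ v
  set a := ⨍ x in B, fn v x with ha
  have hva : MemLp (fun x => fn v x - a) 2 (volume.restrict U) := hvU.sub (memLp_const a)
  have hE : volume B * ∫⁻ x in U, ‖fn v x - a‖ₑ ^ 2
      ≤ ENNReal.ofReal R ^ 2 * (2 ^ d * volume U * ∫⁻ z in U, ‖grad v z‖ₑ ^ 2) := by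
    refine le_trans ?_ (lintegral_lintegral_enorm_fn_sub_sq_le hΩ hb hUo hU hUΩ hR v)
    rw [← lintegral_const_mul' _ _ hBfin]
    refine lintegral_mono fun x => ?_
    exact (volume_mul_enorm_sub_average_sq_le hB (memLp_fn_restrict (hBU.trans hUΩ) v) _).trans
      (lintegral_mono_set hBU)
  rw [lintegral_enorm_sq_eq_ofReal hva, lintegral_enorm_sq_eq_ofReal (memLp_grad_restrict hUΩ v),
    ← ofReal_measureReal hBfin, ← ofReal_measureReal hUfin, ← ENNReal.ofReal_mul measureReal_nonneg,
    ← ENNReal.ofReal_pow hR0, show (2 : ℝ≥0∞) ^ d = ENNReal.ofReal (2 ^ d) by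
      rw [ENNReal.ofReal_pow (by norm_num)]; norm_num,
    ← ENNReal.ofReal_mul (by positivity), ← ENNReal.ofReal_mul (by positivity),
    ← ENNReal.ofReal_mul (by positivity)] at hE
  have hG0 : 0 ≤ ∫ x in U, ‖grad v x‖ ^ 2 := integral_nonneg fun x => by positivity
  rw [ENNReal.ofReal_le_ofReal_iff (by positivity)] at hE
  simp only [Real.norm_eq_abs, sq_abs] at hE
  set G := ∫ x in U, ‖grad v x‖ ^ 2 with hG
  have hE2 : ∫ x in U, (fn v x - a) ^ 2 ≤ η * 2 ^ d * R ^ 2 * G := by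
    refine le_of_mul_le_mul_left (hE.trans ?_) hB
    calc R ^ 2 * (2 ^ d * volume.real U * G) = (2 ^ d * R ^ 2 * G) * volume.real U := by ring
      _ ≤ (2 ^ d * R ^ 2 * G) * (η * volume.real B) := by gcongr
      _ = _ := by ring
  have hsplit : ∫ x in U, fn v x ^ 2
      ≤ 2 * (∫ x in U, (fn v x - a) ^ 2) + 2 * a ^ 2 * volume.real U := by
    have hi : Integrable (fun x => 2 * (fn v x - a) ^ 2) (volume.restrict U) :=
      hva.integrable_sq.const_mul 2
    calc ∫ x in U, fn v x ^ 2 ≤ ∫ x in U, (2 * (fn v x - a) ^ 2 + 2 * a ^ 2) := by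
          refine integral_mono hvU.integrable_sq (hi.add (integrable_const _)) fun x => ?_
          dsimp only
          nlinarith [sq_nonneg (fn v x - 2 * a)]
      _ = _ := by
          rw [integral_add hi (integrable_const _), integral_const_mul]
          simp; ring
  have : 2 * a ^ 2 * volume.real U ≤ 2 * a ^ 2 * (η * volume.real B) := by gcongr
  linarith

/-- The relatively open pieces `interior (K i) ∩ Ω` of the domain. -/
def Patches.U {d m : ℕ} {Ω : Set (Sp d)} (D : Patches Ω m) (i : Fin m) : Set (Sp d) :=
  interior (D.K i) ∩ Ω

namespace Patches

variable {d m : ℕ} {Ω : Set (Sp d)} (D : Patches Ω m)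

theorem U_open (hΩ : IsOpen Ω) (i : Fin m) : IsOpen (D.U i) := isOpen_interior.inter hΩ

theorem U_convex (hΩ : IsOpen Ω) (i : Fin m) : Convex ℝ (D.U i) := by
  have : D.U i = interior (D.K i ∩ Ω) := by rw [interior_inter, hΩ.interior_eq]; rfl
  rw [this]
  exact (D.K_inter_convex i).interior

theorem U_subset (i : Fin m) : D.U i ⊆ Ω := inter_subset_right

theorem U_subset_K (i : Fin m) : D.U i ⊆ D.K i := inter_subset_left.trans interior_subset

theorem B_subset_U (i : Fin m) : D.B i ⊆ D.U i := fun _ hx =>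
  ⟨interior_maximal (D.B_subset_K i) (D.B_open i) hx, D.B_subset i hx⟩

theorem volume_K_ne_top (i : Fin m) : volume (D.K i) ≠ ⊤ := (D.K_bounded i).measure_lt_top.ne

theorem volumeReal_B_pos (i : Fin m) : 0 < volume.real (D.B i) :=
  ENNReal.toReal_pos ((D.B_open i).measure_pos _ (D.B_nonempty i)).ne'
    (measure_ne_top_of_subset (D.B_subset_K i) (D.volume_K_ne_top i))

theorem R_nonneg : 0 ≤ D.R := Real.iSup_nonneg fun _ => diam_nonneg

theorem norm_sub_le_R (i : Fin m) {x y : Sp d} (hx : x ∈ D.U i) (hy : y ∈ D.U i) :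
    ‖x - y‖ ≤ D.R := by
  rw [← dist_eq_norm]
  exact (dist_le_diam_of_mem (D.K_bounded i) (D.U_subset_K i hx) (D.U_subset_K i hy)).trans
    (le_ciSup (f := fun i => diam (D.K i)) (Set.finite_range _).bddAbove i)

theorem volumeReal_U_le (i : Fin m) : volume.real (D.U i) ≤ D.η * volume.real (D.B i) := by
  have hUK : volume.real (D.U i) ≤ volume.real (D.K i) :=
    measureReal_mono (D.U_subset_K i) (D.volume_K_ne_top i)
  unfold Patches.η
  split_ifs with h
  · rw [one_mul, h i]; exact hUK
  · have hB := D.volumeReal_B_pos i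
    have h1 : volume.real (D.K i) / volume.real (D.B i)
        ≤ ⨆ i, volume.real (D.K i) / volume.real (D.B i) :=
      le_ciSup (f := fun i => volume.real (D.K i) / volume.real (D.B i))
        (Set.finite_range _).bddAbove i
    have h0 : 0 ≤ volume.real (D.K i) := measureReal_nonneg
    rw [div_le_iff₀ hB] at h1
    linarith

theorem one_le_η (i : Fin m) : 1 ≤ D.η := by
  have hB := D.volumeReal_B_pos i
  have hUfin : volume (D.U i) ≠ ⊤ :=
    measure_ne_top_of_subset (D.U_subset_K i) (D.volume_K_ne_top i)
  have h1 : volume.real (D.B i) ≤ volume.real (D.U i) := measureReal_mono (D.B_subset_U i) hUfin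
  have h2 := h1.trans (D.volumeReal_U_le i)
  nlinarith

theorem ncard_le_M {x : Sp d} (hx : x ∈ Ω) : {i | x ∈ D.K i}.ncard ≤ D.M := by
  refine le_csSup ⟨m, ?_⟩ (mem_image_of_mem _ hx)
  rintro _ ⟨y, _, rfl⟩
  simpa using Set.ncard_le_card {i | y ∈ D.K i}

/-- No point of `Ω` lies in more than `M` of the pieces. -/
theorem sum_setIntegral_le (hΩ : IsOpen Ω) {F : Sp d → ℝ} (hF : ∀ x, 0 ≤ F x)
    (hFi : IntegrableOn F Ω) : ∑ i, ∫ x in D.U i, F x ≤ D.M * ∫ x in Ω, F x := by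
  classical
  have hUi : ∀ i, ∫ x in D.U i, F x = ∫ x in Ω, (D.U i).indicator F x := by
    intro i
    rw [setIntegral_indicator (D.U_open hΩ i).measurableSet,
      inter_eq_self_of_subset_right (D.U_subset i)]
  simp_rw [hUi]
  rw [← integral_finsetSum _ fun i _ => hFi.indicator (D.U_open hΩ i).measurableSet,
    ← integral_const_mul]
  refine setIntegral_mono_on (integrable_finsetSum _ fun i _ =>
    hFi.indicator (D.U_open hΩ i).measurableSet) (hFi.const_mul _) hΩ.measurableSet fun x hx => ?_
  have h1 : ∑ i, (D.U i).indicator F x = ({i | x ∈ D.U i} : Finset (Fin m)).card * F x := by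
    simp [indicator_apply, Finset.sum_ite]
  rw [h1]
  refine mul_le_mul_of_nonneg_right ?_ (hF x)
  have h2 := D.ncard_le_M hx
  have h3 : ({i | x ∈ D.U i} : Finset (Fin m)).card ≤ {i | x ∈ D.K i}.ncard := by
    rw [← Set.ncard_coe_finset]
    refine Set.ncard_le_ncard (fun i hi => ?_) (Set.toFinite _)
    exact D.U_subset_K i (by simpa using hi)
  exact_mod_cast h3.trans h2

/-- The pieces cover `Ω` up to a null set, as the boundary of a convex set is a null set. -/
theorem ae_exists_mem_U (hΩ : IsOpen Ω) : ∀ᵐ x ∂(volume.restrict Ω), ∃ i, x ∈ D.U i := by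
  have hfr : ∀ᵐ x ∂(volume.restrict Ω), ∀ i, x ∉ frontier (D.K i) :=
    ae_all_iff.2 fun i => ae_restrict_of_ae
      (measure_eq_zero_iff_ae_notMem.1 ((D.K_convex i).addHaar_frontier volume))
  filter_upwards [hfr, ae_restrict_mem hΩ.measurableSet] with x hx hxΩ
  obtain ⟨i, hi⟩ := mem_iUnion.1 (D.cover hxΩ)
  refine ⟨i, ?_, hxΩ⟩
  by_contra h
  exact hx i ⟨hi, h⟩

theorem setIntegral_le_sum (hΩ : IsOpen Ω) {F : Sp d → ℝ} (hF : ∀ x, 0 ≤ F x)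
    (hFi : IntegrableOn F Ω) : ∫ x in Ω, F x ≤ ∑ i, ∫ x in D.U i, F x := by
  have hUi : ∀ i, ∫ x in D.U i, F x = ∫ x in Ω, (D.U i).indicator F x := by
    intro i
    rw [setIntegral_indicator (D.U_open hΩ i).measurableSet,
      inter_eq_self_of_subset_right (D.U_subset i)]
  simp_rw [hUi]
  rw [← integral_finsetSum _ fun i _ => hFi.indicator (D.U_open hΩ i).measurableSet]
  refine integral_mono_ae hFi (integrable_finsetSum _ fun i _ =>
    hFi.indicator (D.U_open hΩ i).measurableSet) ?_
  filter_upwards [D.ae_exists_mem_U hΩ] with x ⟨i, hi⟩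
  calc F x = (D.U i).indicator F x := (indicator_of_mem hi F).symm
    _ ≤ ∑ i, (D.U i).indicator F x :=
      Finset.single_le_sum (f := fun i => (D.U i).indicator F x)
        (fun j _ => indicator_nonneg (fun y _ => hF y) x) (Finset.mem_univ i)

theorem norm_fn_sq_le (hΩ : IsOpen Ω) (hb : Bornology.IsBounded Ω) (hη : 0 ≤ D.η) (v : H1 Ω) :
    ‖fn v‖ ^ 2 ≤ 2 * D.η * 2 ^ d * D.R ^ 2 * (D.M * ‖grad v‖ ^ 2) + 2 * D.η * D.b v v := by
  rw [norm_fn_sq, norm_sq_eq_integral (grad v)]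
  calc ∫ x in Ω, fn v x ^ 2 ≤ ∑ i, ∫ x in D.U i, fn v x ^ 2 :=
        D.setIntegral_le_sum hΩ (fun x => sq_nonneg _) (integrable_fn_sq v)
    _ ≤ ∑ i, (2 * D.η * 2 ^ d * D.R ^ 2 * (∫ x in D.U i, ‖grad v x‖ ^ 2)
        + 2 * D.η * (volume.real (D.B i) * (⨍ x in D.B i, fn v x) * (⨍ x in D.B i, fn v x))) :=
        Finset.sum_le_sum fun i _ => integral_fn_sq_le_of_convex hΩ hb (D.U_open hΩ i)
          (D.U_convex hΩ i) (D.U_subset i) (D.B_subset_U i) D.R_nonneg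
          (fun x hx y hy => D.norm_sub_le_R i hx hy) (D.volumeReal_B_pos i)
          (D.volumeReal_U_le i) v
    _ = 2 * D.η * 2 ^ d * D.R ^ 2 * (∑ i, ∫ x in D.U i, ‖grad v x‖ ^ 2)
        + 2 * D.η * D.b v v := by
        rw [Finset.sum_add_distrib, ← Finset.mul_sum, ← Finset.mul_sum]; rfl
    _ ≤ _ := by
        have := D.sum_setIntegral_le hΩ (fun x => by positivity) (integrable_norm_grad_sq v)
        gcongr

theorem b_nonneg (v : H1 Ω) : 0 ≤ D.b v v :=
  Finset.sum_nonneg fun i _ => by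
    rw [mul_assoc]
    exact mul_nonneg measureReal_nonneg (mul_self_nonneg _)

theorem b_le (hΩ : IsOpen Ω) (v : H1 Ω) : D.b v v ≤ D.M * ‖fn v‖ ^ 2 := by
  rw [norm_fn_sq]
  refine le_trans (Finset.sum_le_sum fun i _ => ?_)
    (D.sum_setIntegral_le hΩ (fun x => sq_nonneg _) (integrable_fn_sq v))
  rw [mul_assoc, ← sq]
  refine (volumeReal_mul_average_sq_le (D.volumeReal_B_pos i)
    (memLp_fn_restrict (D.B_subset i) v)).trans ?_
  exact setIntegral_mono_set ((integrable_fn_sq v).mono_set (D.U_subset i))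
    (ae_of_all _ fun x => sq_nonneg _) (D.B_subset_U i).eventuallyLE

end Patches

/-! ### The bilinear forms and the energy -/

namespace EllipticData

variable {d : ℕ} {Ω : Set (Sp d)} (P : EllipticData Ω)

theorem integrable_α_inner (w v : H1 Ω) :
    IntegrableOn (fun x => P.α x * inner ℝ (grad w x) (grad v x)) Ω := by
  refine (L2.integrable_inner (𝕜 := ℝ) (grad w) (grad v)).bdd_mul (c := P.αMax) P.α_meas ?_
  filter_upwards [P.α_bound] with x hx
  rw [Real.norm_of_nonneg (P.αMin_pos.le.trans hx.1)]
  exact hx.2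

theorem integrable_σ_mul (w v : H1 Ω) : IntegrableOn (fun x => P.σ x * fn w x * fn v x) Ω := by
  have h : IntegrableOn (fun x => P.σ x * (fn w x * fn v x)) Ω := by
    refine ((Lp.memLp (fn w)).integrable_mul (Lp.memLp (fn v))).bdd_mul (c := P.σMax) P.σ_meas ?_
    filter_upwards [P.σ_bound] with x hx
    rw [Real.norm_of_nonneg hx.1]
    exact hx.2
  simpa only [mul_assoc] using h

theorem integrable_a (w v : H1 Ω) : IntegrableOn
    (fun x => P.α x * inner ℝ (grad w x) (grad v x) + P.σ x * fn w x * fn v x) Ω :=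
  (P.integrable_α_inner w v).add (P.integrable_σ_mul w v)

theorem a_comm (w v : H1 Ω) : P.a w v = P.a v w := by
  refine integral_congr_ae (ae_of_all _ fun x => ?_)
  dsimp only
  rw [real_inner_comm]
  ring

theorem a_add_right (u v w : H1 Ω) : P.a u (v + w) = P.a u v + P.a u w := by
  unfold EllipticData.a
  rw [← integral_add (P.integrable_a u v) (P.integrable_a u w)]
  refine integral_congr_ae ?_
  filter_upwards [Lp.coeFn_add (fn v) (fn w), Lp.coeFn_add (grad v) (grad w)] with x h1 h2
  have h1' : fn (v + w) x = fn v x + fn w x := h1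
  have h2' : grad (v + w) x = grad v x + grad w x := h2
  rw [h1', h2', inner_add_right]
  ring

theorem mul_norm_grad_sq_le_a (v : H1 Ω) : P.αMin * ‖grad v‖ ^ 2 ≤ P.a v v := by
  rw [norm_sq_eq_integral, ← integral_const_mul]
  refine integral_mono_ae ((integrable_norm_grad_sq v).const_mul _) (P.integrable_a v v) ?_
  filter_upwards [P.α_bound, P.σ_bound] with x hα hσ
  rw [real_inner_self_eq_norm_sq, mul_assoc]
  have h1 := mul_le_mul_of_nonneg_right hα.1 (sq_nonneg ‖grad v x‖)
  have h2 := mul_nonneg hσ.1 (mul_self_nonneg (fn v x))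
  linarith

theorem a_le (v : H1 Ω) : P.a v v ≤ P.αMax * ‖grad v‖ ^ 2 + P.σMax * ‖fn v‖ ^ 2 := by
  rw [norm_sq_eq_integral, norm_fn_sq, ← integral_const_mul, ← integral_const_mul,
    ← integral_add ((integrable_norm_grad_sq v).const_mul _) ((integrable_fn_sq v).const_mul _)]
  refine integral_mono_ae (P.integrable_a v v) (((integrable_norm_grad_sq v).const_mul _).add
    ((integrable_fn_sq v).const_mul _)) ?_
  filter_upwards [P.α_bound, P.σ_bound] with x hα hσ
  rw [real_inner_self_eq_norm_sq, mul_assoc, ← sq]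
  have h1 := mul_le_mul_of_nonneg_right hα.2 (sq_nonneg ‖grad v x‖)
  have h2 := mul_le_mul_of_nonneg_right hσ.2 (sq_nonneg (fn v x))
  linarith

theorem a_self_nonneg (v : H1 Ω) : 0 ≤ P.a v v :=
  (mul_nonneg P.αMin_pos.le (sq_nonneg _)).trans (P.mul_norm_grad_sq_le_a v)

end EllipticData

namespace Patches

variable {d m : ℕ} {Ω : Set (Sp d)} (D : Patches Ω m)

theorem average_add (i : Fin m) (v w : H1 Ω) :
    ⨍ x in D.B i, fn (v + w) x = (⨍ x in D.B i, fn v x) + ⨍ x in D.B i, fn w x := by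
  have hfin : IsFiniteMeasure (volume.restrict (D.B i)) :=
    ⟨by simpa using (measure_ne_top_of_subset (D.B_subset_K i) (D.volume_K_ne_top i)).lt_top⟩
  have hi : ∀ v : H1 Ω, IntegrableOn (fn v) (D.B i) := fun v =>
    (memLp_fn_restrict (D.B_subset i) v).integrable (by norm_num)
  rw [setAverage_eq, setAverage_eq, setAverage_eq, ← smul_add, ← integral_add (hi v) (hi w)]
  congr 1
  refine integral_congr_ae (ae_restrict_of_ae_restrict_of_subset (D.B_subset i) ?_)
  filter_upwards [Lp.coeFn_add (fn v) (fn w)] with x hx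
  exact hx

theorem b_comm (w v : H1 Ω) : D.b w v = D.b v w :=
  Finset.sum_congr rfl fun _ _ => by ring

theorem b_add_right (u v w : H1 Ω) : D.b u (v + w) = D.b u v + D.b u w := by
  unfold Patches.b
  rw [← Finset.sum_add_distrib]
  refine Finset.sum_congr rfl fun i _ => ?_
  rw [D.average_add]
  ring

/-- The data error always belongs to `L²(Ω)`, being a combination of local averages. -/
theorem isL2Functional_dataResidual (V : Submodule ℝ (H1 Ω)) (β : Fin m → ℝ) (u : H1 Ω) :
    IsL2Functional V (dataResidual D β u) := by
  have hμ : ∀ i, volume.restrict Ω (D.B i) ≠ ⊤ := fun i =>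
    ((Measure.restrict_le_self _).trans_lt
      (measure_ne_top_of_subset (D.B_subset_K i) (D.volume_K_ne_top i)).lt_top).ne
  refine ⟨∑ i, (β i - ⨍ x in D.B i, fn u x) •
    indicatorConstLp 2 (D.B_open i).measurableSet (hμ i) (1 : ℝ), fun v _ => ?_⟩
  have hin : ∀ g : L2 Ω, ∫ x in Ω, g x * fn v x = inner ℝ g (fn v) := by
    intro g
    rw [L2.inner_def]
    refine integral_congr_ae (ae_of_all _ fun x => ?_)
    simp [mul_comm]
  rw [hin, sum_inner, dataResidual, Patches.bData, Patches.b, ← Finset.sum_sub_distrib]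
  refine Finset.sum_congr rfl fun i _ => ?_
  rw [real_inner_smul_left, L2.inner_indicatorConstLp_one,
    Measure.restrict_restrict (D.B_open i).measurableSet,
    inter_eq_self_of_subset_left (D.B_subset i),
    ← volumeReal_mul_average (D.volumeReal_B_pos i)]
  ring

end Patches

section Energy

variable {d m : ℕ} {Ω : Set (Sp d)} (P : EllipticData Ω) (D : Patches Ω m)

theorem augForm_comm (δ : ℝ) (v w : H1 Ω) : augForm P D δ v w = augForm P D δ w v := by
  rw [augForm, augForm, P.a_comm, D.b_comm]

theorem augForm_add_right (δ : ℝ) (u v w : H1 Ω) :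
    augForm P D δ u (v + w) = augForm P D δ u v + augForm P D δ u w := by
  rw [augForm, augForm, augForm, P.a_add_right, D.b_add_right]
  ring

theorem augForm_self_nonneg {δ : ℝ} (hδ : 0 < δ) (v : H1 Ω) : 0 ≤ augForm P D δ v v :=
  add_nonneg (P.a_self_nonneg v) (mul_nonneg (by positivity) (D.b_nonneg v))

theorem sq_augNorm {δ : ℝ} (hδ : 0 < δ) (v : H1 Ω) : augNorm P D δ v ^ 2 = augForm P D δ v v :=
  Real.sq_sqrt (augForm_self_nonneg P D hδ v)

/-- Completing the square: up to a constant and the residuals, the energy of `v` is half of the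
squared distance to `u`. -/
theorem energy_eq (δ : ℝ) (β : Fin m → ℝ) (u v : H1 Ω) :
    energy P D δ β v = augForm P D δ (v - u) (v - u) / 2 - augForm P D δ u u / 2
      - (pdeResidual P u v + δ⁻¹ * dataResidual D β u v) := by
  obtain ⟨w, rfl⟩ : ∃ w, v = u + w := ⟨v - u, by abel⟩
  rw [add_sub_cancel_left]
  have h1 : augForm P D δ (u + w) (u + w)
      = augForm P D δ u u + 2 * augForm P D δ u w + augForm P D δ w w := by
    rw [augForm_add_right, augForm_comm P D δ (u + w) u, augForm_comm P D δ (u + w) w,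
      augForm_add_right, augForm_add_right, augForm_comm P D δ w u]
    ring
  have h2 := augForm_add_right P D δ u u w
  unfold energy pdeResidual dataResidual
  rw [h1]
  unfold augForm at h2 ⊢
  linear_combination -h2

theorem Represents.eq_inner {V : Submodule ℝ (H1 Ω)} {F : H1 Ω → ℝ} {g : L2 Ω}
    (h : Represents V F g) {v : H1 Ω} (hv : v ∈ V) : F v = inner ℝ g (fn v) := by
  rw [h v hv, L2.inner_def]
  refine integral_congr_ae (ae_of_all _ fun x => ?_)
  simp [mul_comm]

/-- The abstract error estimate: if the `L²`-norm is bounded by `L` times the augmented norm,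
then a minimizer is quasi-optimal up to the residuals, which are measured in the dual norm. -/
theorem augNorm_minimizer_sub_le {V : Submodule ℝ (H1 Ω)} {u : H1 Ω} {δ : ℝ} (hδ : 0 < δ)
    {β : Fin m → ℝ} {Vh : Set (H1 Ω)} (hVh : Vh ⊆ (V : Set (H1 Ω))) {uh : H1 Ω}
    (huh : IsMinimizer P D δ β Vh uh) {L : ℝ} (hL0 : 0 ≤ L)
    (hL : ∀ v : H1 Ω, ‖fn v‖ ≤ L * augNorm P D δ v) {g h : L2 Ω}
    (hg : Represents V (pdeResidual P u) g) (hh : Represents V (dataResidual D β u) h)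
    {v : H1 Ω} (hv : v ∈ Vh) :
    augNorm P D δ (uh - u) ≤ augNorm P D δ (v - u) + 2 * (L * (‖g‖ + δ⁻¹ * ‖h‖)) := by
  have hmin := huh.2 v hv
  rw [energy_eq P D δ β u uh, energy_eq P D δ β u v, ← sq_augNorm P D hδ (uh - u),
    ← sq_augNorm P D hδ (v - u), hg.eq_inner (hVh huh.1), hg.eq_inner (hVh hv), hh.eq_inner (hVh huh.1),
    hh.eq_inner (hVh hv)] at hmin
  have e1 : fn uh = fn (uh - u) + fn u := (sub_add_cancel (fn uh) (fn u)).symm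
  have e2 : fn v = fn (v - u) + fn u := (sub_add_cancel (fn v) (fn u)).symm
  rw [e1, e2] at hmin
  simp only [inner_add_right] at hmin
  set X := augNorm P D δ (uh - u) with hX
  set Y := augNorm P D δ (v - u) with hY
  have hX0 : 0 ≤ X := Real.sqrt_nonneg _
  have hY0 : 0 ≤ Y := Real.sqrt_nonneg _
  have hres : ∀ w : H1 Ω, |inner ℝ g (fn w) + δ⁻¹ * inner ℝ h (fn w)|
      ≤ (‖g‖ + δ⁻¹ * ‖h‖) * (L * augNorm P D δ w) := by
    intro w
    have hδ' : 0 < δ⁻¹ := inv_pos.2 hδ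
    calc |inner ℝ g (fn w) + δ⁻¹ * inner ℝ h (fn w)|
        ≤ |inner ℝ g (fn w)| + δ⁻¹ * |inner ℝ h (fn w)| := by
          refine (abs_add_le _ _).trans (le_of_eq ?_)
          rw [abs_mul, abs_of_pos hδ']
      _ ≤ ‖g‖ * ‖fn w‖ + δ⁻¹ * (‖h‖ * ‖fn w‖) := by
          gcongr <;> exact abs_real_inner_le_norm _ _
      _ = (‖g‖ + δ⁻¹ * ‖h‖) * ‖fn w‖ := by ring
      _ ≤ _ := mul_le_mul_of_nonneg_left (hL w) (by positivity)
  have h1 := (abs_le.1 (hres (uh - u))).2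
  have h2 := (abs_le.1 (hres (v - u))).1
  rw [← hX] at h1
  rw [← hY] at h2
  set κ := L * (‖g‖ + δ⁻¹ * ‖h‖) with hκ
  have e3 : ∀ t, (‖g‖ + δ⁻¹ * ‖h‖) * (L * t) = κ * t := fun t => by rw [hκ]; ring
  rw [e3] at h1 h2
  have hκ0 : 0 ≤ κ := by
    have : 0 < δ⁻¹ := inv_pos.2 hδ
    positivity
  -- the estimate reads `X ^ 2 ≤ Y ^ 2 + 2 * κ * (X + Y)`, i.e. `(X - κ) ^ 2 ≤ (Y + κ) ^ 2`
  have h3 : (X - κ) ^ 2 ≤ (Y + κ) ^ 2 := by linarith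
  have h4 := abs_le_of_sq_le_sq h3 (by positivity)
  linarith [le_abs_self (X - κ)]

end Energy

/-! ### The norm equivalence and the error estimate -/

section Constants

variable {d m : ℕ} {Ω : Set (Sp d)} (Q : EllipticData Ω) (D : Patches Ω m)

/-- The constant in the bound of the `L²`-norm by the augmented norm. -/
noncomputable def poincareConst (d : ℕ) : ℝ := 2 * 2 ^ d * Real.pi ^ 2

theorem poincareConst_pos (d : ℕ) : 0 < poincareConst d := by
  unfold poincareConst; positivity

theorem one_le_pi_sq : 1 ≤ Real.pi ^ 2 := by nlinarith [Real.pi_gt_three]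

theorem gammaConst_nonneg (hη : 0 ≤ D.η) {δ : ℝ} (hδ : 0 < δ) : 0 ≤ gammaConst Q D δ :=
  mul_nonneg hη (hδ.le.trans (le_max_right _ _))

/-- The augmented norm controls the `L²`-norm: the overlapping local Poincaré inequalities bound
`‖v‖` by the gradient, hence by the form `a`, and by the local averages, hence by the form `b`. -/
theorem norm_fn_sq_le_augNorm (hΩ : IsOpen Ω) (hb : Bornology.IsBounded Ω) (hη : 0 ≤ D.η)
    {δ : ℝ} (hδ : 0 < δ) (v : H1 Ω) :
    ‖fn v‖ ^ 2 ≤ poincareConst d * gammaConst Q D δ * augNorm Q D δ v ^ 2 := by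
  set Γ := gammaConst Q D δ with hΓ
  have hα := Q.αMin_pos
  have hΓ0 : 0 ≤ Γ := gammaConst_nonneg Q D hη hδ
  have hG1 : D.η * D.R ^ 2 * D.M ≤ Real.pi ^ 2 * Q.αMin * Γ := by
    have h1 : D.η * (D.R ^ 2 * D.M / (Real.pi ^ 2 * Q.αMin)) ≤ Γ :=
      mul_le_mul_of_nonneg_left (le_max_left _ _) hη
    calc D.η * D.R ^ 2 * D.M
        = Real.pi ^ 2 * Q.αMin * (D.η * (D.R ^ 2 * D.M / (Real.pi ^ 2 * Q.αMin))) := by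
          field_simp
      _ ≤ _ := by gcongr
  have hG2 : D.η ≤ Γ * δ⁻¹ := by
    rw [← div_eq_mul_inv, le_div_iff₀ hδ]
    exact mul_le_mul_of_nonneg_left (le_max_right _ _) hη
  have ha := Q.mul_norm_grad_sq_le_a v
  have hb0 := D.b_nonneg v
  have h2d : (1 : ℝ) ≤ 2 ^ d := one_le_pow₀ (by norm_num)
  rw [sq_augNorm Q D hδ, augForm, poincareConst]
  calc ‖fn v‖ ^ 2
      ≤ 2 * D.η * 2 ^ d * D.R ^ 2 * (D.M * ‖grad v‖ ^ 2) + 2 * D.η * D.b v v :=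
        D.norm_fn_sq_le hΩ hb hη v
    _ = 2 * 2 ^ d * (D.η * D.R ^ 2 * D.M) * ‖grad v‖ ^ 2 + 2 * 1 * 1 * D.η * D.b v v := by ring
    _ ≤ 2 * 2 ^ d * (Real.pi ^ 2 * Q.αMin * Γ) * ‖grad v‖ ^ 2
        + 2 * 2 ^ d * Real.pi ^ 2 * (Γ * δ⁻¹) * D.b v v := by
        gcongr
        exact one_le_pi_sq
    _ = 2 * 2 ^ d * Real.pi ^ 2 * Γ * (Q.αMin * ‖grad v‖ ^ 2)
        + 2 * 2 ^ d * Real.pi ^ 2 * Γ * (δ⁻¹ * D.b v v) := by ring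
    _ ≤ 2 * 2 ^ d * Real.pi ^ 2 * Γ * (Q.a v v)
        + 2 * 2 ^ d * Real.pi ^ 2 * Γ * (δ⁻¹ * D.b v v) := by gcongr
    _ = _ := by ring

theorem norm_fn_le_augNorm (hΩ : IsOpen Ω) (hb : Bornology.IsBounded Ω) (hη : 0 ≤ D.η)
    {δ : ℝ} (hδ : 0 < δ) (v : H1 Ω) :
    ‖fn v‖ ≤ Real.sqrt (poincareConst d * gammaConst Q D δ) * augNorm Q D δ v := by
  have hΓ0 := gammaConst_nonneg Q D hη hδ
  have hA : 0 ≤ augNorm Q D δ v := Real.sqrt_nonneg _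
  refine (sq_le_sq₀ (by positivity) (by positivity)).1 ?_
  rw [mul_pow, Real.sq_sqrt (mul_nonneg (poincareConst_pos d).le hΓ0)]
  exact norm_fn_sq_le_augNorm Q D hΩ hb hη hδ v

/-- If `δ` is balanced, both entries of the maximum in `Γ` are comparable to `δ`. -/
theorem gammaConst_mul_inv_le {δ Θ ηup : ℝ} (hη : 0 ≤ D.η) (hηup : D.η ≤ ηup) (hδ : 0 < δ)
    (hw : WellBalanced Q D δ Θ) : gammaConst Q D δ * δ⁻¹ ≤ ηup * Θ := by
  obtain ⟨θ, ⟨hθ0, hθ1⟩, hθΘ, hlow, -⟩ := hw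
  have hinv : 1 ≤ θ⁻¹ := (one_le_inv₀ hθ0).2 hθ1
  have hmax : max (D.R ^ 2 * D.M / (Real.pi ^ 2 * Q.αMin)) δ ≤ Θ * δ := by
    refine max_le ?_ ?_
    · calc _ ≤ θ⁻¹ * δ := by rwa [le_inv_mul_iff₀ hθ0]
        _ ≤ Θ * δ := by gcongr
    · nlinarith
  rw [← div_eq_mul_inv, div_le_iff₀ hδ, gammaConst, mul_assoc]
  exact mul_le_mul hηup hmax (hδ.le.trans (le_max_right _ _)) (hη.trans hηup)

/-- If `δ` is balanced, then `Γ` is at most of the order of `R²`. -/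
theorem gammaConst_le {δ Θ ηup Mup αlow : ℝ} (hη : 0 ≤ D.η) (hηup : D.η ≤ ηup) (hδ : 0 < δ)
    (hM : (D.M : ℝ) ≤ Mup) (hαlow : 0 < αlow) (hα : αlow ≤ Q.αMin)
    (hw : WellBalanced Q D δ Θ) : gammaConst Q D δ ≤ ηup * Θ * Mup / αlow * D.R ^ 2 := by
  obtain ⟨θ, ⟨hθ0, hθ1⟩, hθΘ, -, hup⟩ := hw
  have hinv : 1 ≤ θ⁻¹ := (one_le_inv₀ hθ0).2 hθ1
  set T := D.R ^ 2 * D.M / (Real.pi ^ 2 * Q.αMin) with hT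
  have hαQ := Q.αMin_pos
  have hT0 : 0 ≤ T := by positivity
  have hTle : T ≤ D.R ^ 2 * Mup / (1 * αlow) := by
    have hM0 : (0 : ℝ) ≤ D.M := Nat.cast_nonneg _
    have := one_le_pi_sq
    rw [hT]
    have hMup : 0 ≤ Mup := hM0.trans hM
    gcongr
  have hmax : max T δ ≤ Θ * T := by
    refine max_le (by nlinarith) (hup.trans ?_)
    gcongr
  have hΘ : 0 ≤ Θ := by linarith
  have hηup0 : 0 ≤ ηup := hη.trans hηup
  calc gammaConst Q D δ ≤ ηup * (Θ * T) :=
        mul_le_mul hηup hmax (hδ.le.trans (le_max_right _ _)) hηup0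
    _ ≤ ηup * (Θ * (D.R ^ 2 * Mup / (1 * αlow))) := by gcongr
    _ = _ := by ring

/-- The augmented norm, scaled by `√Γ`, is bounded by the scaled `H¹`-norm. -/
theorem sqrt_gammaConst_mul_augNorm_le (hΩ : IsOpen Ω) {δ A N αup σup Rup Mup : ℝ} (hδ : 0 < δ)
    (hΓ0 : 0 ≤ gammaConst Q D δ) (hA : gammaConst Q D δ ≤ A * D.R ^ 2) (hA0 : 0 ≤ A)
    (hN : gammaConst Q D δ * δ⁻¹ ≤ N) (hα : Q.αMax ≤ αup) (hσ : Q.σMax ≤ σup)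
    (hR : D.R ≤ Rup) (hM : (D.M : ℝ) ≤ Mup) (v : H1 Ω) :
    Real.sqrt (gammaConst Q D δ) * augNorm Q D δ v
      ≤ Real.sqrt (A * |αup| + A * Rup ^ 2 * |σup| + N * Mup)
        * (D.R * ‖grad v‖ + ‖fn v‖) := by
  have hR0 := D.R_nonneg
  have hδ' : 0 < δ⁻¹ := inv_pos.2 hδ
  have hN0 : 0 ≤ N := (mul_nonneg hΓ0 hδ'.le).trans hN
  have hM0 : 0 ≤ Mup := (Nat.cast_nonneg _).trans hM
  have hv0 : 0 ≤ augNorm Q D δ v := Real.sqrt_nonneg _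
  refine (sq_le_sq₀ (by positivity) (by positivity)).1 ?_
  rw [mul_pow, mul_pow, sq_augNorm Q D hδ, Real.sq_sqrt hΓ0, Real.sq_sqrt (by positivity), augForm]
  set Γ := gammaConst Q D δ with hΓ
  have ha : Q.a v v ≤ |αup| * ‖grad v‖ ^ 2 + |σup| * ‖fn v‖ ^ 2 := by
    refine (Q.a_le v).trans ?_
    have h1 := hα.trans (le_abs_self αup)
    have h2 := hσ.trans (le_abs_self σup)
    gcongr
  have hb : D.b v v ≤ Mup * ‖fn v‖ ^ 2 := (D.b_le hΩ v).trans (by gcongr)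
  have hR2 : D.R ^ 2 ≤ Rup ^ 2 := by gcongr
  have hb0 := D.b_nonneg v
  have hMv : 0 ≤ Mup * ‖fn v‖ ^ 2 := by positivity
  calc Γ * (Q.a v v + δ⁻¹ * D.b v v)
      = Γ * Q.a v v + Γ * δ⁻¹ * D.b v v := by ring
    _ ≤ Γ * (|αup| * ‖grad v‖ ^ 2 + |σup| * ‖fn v‖ ^ 2) + N * (Mup * ‖fn v‖ ^ 2) := by gcongr
    _ ≤ A * D.R ^ 2 * (|αup| * ‖grad v‖ ^ 2 + |σup| * ‖fn v‖ ^ 2)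
        + N * (Mup * ‖fn v‖ ^ 2) := by gcongr
    _ = A * |αup| * (D.R ^ 2 * ‖grad v‖ ^ 2) + A * D.R ^ 2 * |σup| * ‖fn v‖ ^ 2
        + N * Mup * ‖fn v‖ ^ 2 := by ring
    _ ≤ A * |αup| * (D.R * ‖grad v‖ + ‖fn v‖) ^ 2
        + A * Rup ^ 2 * |σup| * (D.R * ‖grad v‖ + ‖fn v‖) ^ 2
        + N * Mup * (D.R * ‖grad v‖ + ‖fn v‖) ^ 2 := by
        have hg : 0 ≤ D.R * ‖grad v‖ := by positivity
        have hf : 0 ≤ ‖fn v‖ := norm_nonneg _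
        have h1 : D.R ^ 2 * ‖grad v‖ ^ 2 ≤ (D.R * ‖grad v‖ + ‖fn v‖) ^ 2 := by nlinarith
        have h2 : ‖fn v‖ ^ 2 ≤ (D.R * ‖grad v‖ + ‖fn v‖) ^ 2 := by nlinarith
        gcongr
    _ = _ := by ring

end Constants

theorem le_add_mul_csInf {S : Set ℝ} (hS : S.Nonempty) {x a c : ℝ} (hc : 0 ≤ c)
    (h : ∀ t ∈ S, x ≤ a + c * t) : x ≤ a + c * sInf S := by
  rcases hc.eq_or_lt with rfl | hc
  · obtain ⟨t, ht⟩ := hS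
    simpa using h t ht
  have : (x - a) / c ≤ sInf S := le_csInf hS fun t ht => by
    rw [div_le_iff₀ hc]; linarith [h t ht]
  rw [div_le_iff₀ hc] at this
  linarith

theorem IsL2Functional.nonempty_norms {d : ℕ} {Ω : Set (Sp d)} {V : Submodule ℝ (H1 Ω)}
    {F : H1 Ω → ℝ} (h : IsL2Functional V F) :
    {t : ℝ | ∃ g : L2 Ω, Represents V F g ∧ t = ‖g‖}.Nonempty :=
  let ⟨g, hg⟩ := h; ⟨‖g‖, g, hg, rfl⟩

/-- The estimate of the minimizer in `L²` with explicit constants. -/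
theorem norm_minimizer_sub_le {d m : ℕ} {Ω : Set (Sp d)} (Q : EllipticData Ω)
    (D : Patches Ω m) (hΩ : IsOpen Ω) (hb : Bornology.IsBounded Ω) (hη : 0 ≤ D.η)
    {V : Submodule ℝ (H1 Ω)} {u : H1 Ω} {δ : ℝ} (hδ : 0 < δ) {β : Fin m → ℝ} {A N C₀ : ℝ}
    (hA : gammaConst Q D δ ≤ A * D.R ^ 2) (hA0 : 0 ≤ A) (hN : gammaConst Q D δ * δ⁻¹ ≤ N)
    (hN0 : 0 ≤ N) (hC₀ : 0 ≤ C₀)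
    (hup : ∀ v : H1 Ω, Real.sqrt (gammaConst Q D δ) * augNorm Q D δ v
      ≤ C₀ * (D.R * ‖grad v‖ + ‖fn v‖))
    (hres : IsL2Functional V (pdeResidual Q u)) {Vh : Set (H1 Ω)}
    (hVh : Vh ⊆ (V : Set (H1 Ω))) {uh : H1 Ω} (huh : IsMinimizer Q D δ β Vh uh) :
    ‖fn (uh - u)‖ ≤ Real.sqrt (poincareConst d) * C₀ * Eapprox D Vh u
      + 2 * poincareConst d * A * D.R ^ 2 * Epde Q V u
      + 2 * poincareConst d * N * Edata D β V u := by
  have hp := (poincareConst_pos d).le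
  set Γ := gammaConst Q D δ with hΓ
  have hΓ0 : 0 ≤ Γ := gammaConst_nonneg Q D hη hδ
  have hLsq : Real.sqrt (poincareConst d * Γ) * Real.sqrt (poincareConst d * Γ)
      = poincareConst d * Γ := Real.mul_self_sqrt (by positivity)
  have hL : ∀ v : H1 Ω, ‖fn v‖ ≤ Real.sqrt (poincareConst d * Γ) * augNorm Q D δ v :=
    norm_fn_le_augNorm Q D hΩ hb hη hδ
  have key : ∀ g h : L2 Ω, Represents V (pdeResidual Q u) g → Represents V (dataResidual D β u) h →
      ∀ v ∈ Vh, ‖fn (uh - u)‖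
        ≤ Real.sqrt (poincareConst d) * C₀ * (D.R * ‖grad (v - u)‖ + ‖fn (v - u)‖)
          + 2 * poincareConst d * A * D.R ^ 2 * ‖g‖ + 2 * poincareConst d * N * ‖h‖ := by
    intro g h hg hh v hv
    have h1 := augNorm_minimizer_sub_le Q D hδ hVh huh (Real.sqrt_nonneg _) hL hg hh hv
    calc ‖fn (uh - u)‖
        ≤ Real.sqrt (poincareConst d * Γ) * augNorm Q D δ (uh - u) := hL _
      _ ≤ Real.sqrt (poincareConst d * Γ) * (augNorm Q D δ (v - u)
            + 2 * (Real.sqrt (poincareConst d * Γ) * (‖g‖ + δ⁻¹ * ‖h‖))) := by gcongr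
      _ = Real.sqrt (poincareConst d * Γ) * augNorm Q D δ (v - u)
            + 2 * (Real.sqrt (poincareConst d * Γ) * Real.sqrt (poincareConst d * Γ))
              * (‖g‖ + δ⁻¹ * ‖h‖) := by ring
      _ = Real.sqrt (poincareConst d) * (Real.sqrt Γ * augNorm Q D δ (v - u))
            + 2 * poincareConst d * Γ * ‖g‖ + 2 * poincareConst d * (Γ * δ⁻¹) * ‖h‖ := by
          rw [hLsq, Real.sqrt_mul hp]; ring
      _ ≤ Real.sqrt (poincareConst d) * (C₀ * (D.R * ‖grad (v - u)‖ + ‖fn (v - u)‖))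
            + 2 * poincareConst d * (A * D.R ^ 2) * ‖g‖ + 2 * poincareConst d * N * ‖h‖ := by
          gcongr Real.sqrt (poincareConst d) * ?_ + 2 * poincareConst d * ?_ * ‖g‖
            + 2 * poincareConst d * ?_ * ‖h‖
          exact hup _
      _ = _ := by ring
  have hdata := D.isL2Functional_dataResidual V β u
  have hR := D.R_nonneg
  -- the estimate holds for every representative and every competitor, so the infima can be taken
  refine le_add_mul_csInf hdata.nonempty_norms (by positivity) ?_
  rintro _ ⟨h, hh, rfl⟩
  rw [add_right_comm]
  refine le_add_mul_csInf hres.nonempty_norms (by positivity) ?_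
  rintro _ ⟨g, hg, rfl⟩
  rw [add_assoc, add_comm]
  refine le_add_mul_csInf (Set.Nonempty.image _ ⟨uh, huh.1⟩) (by positivity) ?_
  rintro _ ⟨v, hv, rfl⟩
  have := key g h hg hh v hv
  dsimp only
  linarith

end PDELearning

open PDELearning in
theorem mainTheorem10 (d : ℕ) (αlow αup σup Rup ηup Mup Θ : ℝ) (hαlow : 0 < αlow) :
    ∃ C : ℝ, 0 < C ∧
      ∀ (Ω : Set (Sp d)), IsOpen Ω → IsConnected Ω → Bornology.IsBounded Ω →
      ∀ (m : ℕ) (D : Patches Ω m) (P Q : EllipticData Ω) (V : Submodule ℝ (H1 Ω))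
        (u : H1 Ω) (δ : ℝ) (β : Fin m → ℝ),
        IsClosed (V : Set (H1 Ω)) → H10 Ω ≤ V →
        P.IsCoerciveOn V → P.IsSolution V u →
        αlow ≤ Q.αMin → Q.αMax ≤ αup → Q.σMax ≤ σup →
        D.R ≤ Rup → D.η ≤ ηup → (D.M : ℝ) ≤ Mup →
        0 < δ → WellBalanced Q D δ Θ →
        (∀ v : H1 Ω, Real.sqrt (gammaConst Q D δ) * augNorm Q D δ v
            ≤ C * (D.R * ‖grad v‖ + ‖fn v‖)) ∧
        (IsL2Functional V (pdeResidual Q u) →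
          ∀ (Vh : Set (H1 Ω)), Vh ⊆ (V : Set (H1 Ω)) →
          ∀ uh : H1 Ω, IsMinimizer Q D δ β Vh uh →
            ‖fn (uh - u)‖
              ≤ C * Eapprox D Vh u + C * D.R ^ 2 * Epde Q V u + C * Edata D β V u) := by
  -- absolute values make the constants nonnegative before the problem is known
  set N : ℝ := |ηup * Θ| with hN
  set A : ℝ := |ηup * Θ * Mup / αlow| with hA
  set C₀ : ℝ := Real.sqrt (A * |αup| + A * Rup ^ 2 * |σup| + N * Mup) with hC₀
  have hp := poincareConst_pos d
  have hN0 : 0 ≤ N := abs_nonneg _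
  have hA0 : 0 ≤ A := abs_nonneg _
  have hC₀0 : 0 ≤ C₀ := Real.sqrt_nonneg _
  have h1 : 0 ≤ Real.sqrt (poincareConst d) * C₀ := by positivity
  have h2 : 0 ≤ 2 * poincareConst d * A := by positivity
  have h3 : 0 ≤ 2 * poincareConst d * N := by positivity
  refine ⟨1 + C₀ + Real.sqrt (poincareConst d) * C₀ + 2 * poincareConst d * A
    + 2 * poincareConst d * N, by positivity, ?_⟩
  intro Ω hΩ hconn hb m D P Q V u δ β _ _ _ _ hα hαup hσup hR hη hM hδ hw
  obtain ⟨x, hx⟩ := hconn.nonempty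
  obtain ⟨i, -⟩ := mem_iUnion.1 (D.cover hx)
  have hη0 : 0 ≤ D.η := zero_le_one.trans (D.one_le_η i)
  have hR0 := D.R_nonneg
  have hΓA : gammaConst Q D δ ≤ A * D.R ^ 2 :=
    (gammaConst_le Q D hη0 hη hδ hM hαlow hα hw).trans (by gcongr; exact le_abs_self _)
  have hΓN : gammaConst Q D δ * δ⁻¹ ≤ N :=
    (gammaConst_mul_inv_le Q D hη0 hη hδ hw).trans (le_abs_self _)
  have hup := sqrt_gammaConst_mul_augNorm_le Q D hΩ hδ (gammaConst_nonneg Q D hη0 hδ) hΓA hA0 hΓN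
    hαup hσup hR hM
  refine ⟨fun v => (hup v).trans ?_, fun hres Vh hVh uh huh => ?_⟩
  · rw [← hC₀]
    gcongr
    linarith
  · refine (norm_minimizer_sub_le Q D hΩ hb hη0 hδ hΓA hA0 hΓN hN0 hC₀0 hup hres hVh huh).trans ?_
    have hE1 : 0 ≤ Eapprox D Vh u := Real.sInf_nonneg (by rintro _ ⟨v, _, rfl⟩; positivity)
    have hE2 : 0 ≤ Epde Q V u := Real.sInf_nonneg (by rintro _ ⟨g, _, rfl⟩; positivity)
    have hE3 : 0 ≤ Edata D β V u := Real.sInf_nonneg (by rintro _ ⟨g, _, rfl⟩; positivity)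
    gcongr <;> linarith
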